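/- Call a lattice $\Lambda\subset\mathbb R^2$ (a discrete subgroup spanning $\mathbb R^2$; generating matrices have a $\mathbb Z$-basis of $\Lambda$ as columns) irrational if no two distinct points of $\Lambda$ lie on a common horizontal or vertical line. Two real $2\times2$ matrices are NBA-equivalent if one is obtained from the other by finitely many of the operations: left multiplication by $\operatorname{diag}(a,b)$ with $ab\ne0$, left multiplication by $\begin{pmatrix}0&1\\1&0\end{pmatrix}$, right multiplication by an element of $\mathrm{GL}_2(\mathbb Z)$ (and their inverses); two lattices are NBA-equivalent if they have NBA-equivalent generating matrices. Let $\operatorname{disp}(\Lambda)\in[0,\infty]$ be the supremum of the areas of all open axis-parallel boxes containing no point of $\Lambda$, and call $\operatorname{disp}(\Lambda)/\det(\Lambda)$ the normalized dispersion, where $\det(\Lambda)$ is the covolume. For a two-sided sequence $\mathfrak A=(a_i)_{i\in\mathbb Z}$ of positive integers and $i\in\mathbb Z$ put $$\Delta_i=[a_i,a_{i+1},a_{i+2},\dots],\qquad -\widetilde\Delta_i=[0,a_{i-1},a_{i-2},\dots]$$ (values of continued fractions), and $$\operatorname{disp}(\mathfrak A)=\sup_{i\in\mathbb Z}\ \max_{0\le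 j<a_i}\frac{(1-j+\Delta_i)(1+j-\widetilde\Delta_i)}{\Delta_i-\widetilde\Delta_i}\in[0,\infty].$$ Then there is a bijection between the set of NBA-equivalence classes of irrational lattices and the set of two-sided sequences of positive integers modulo shifts $(a_i)\mapsto(a_{i+k})$, $k\in\mathbb Z$, and the reversal $(a_i)\mapsto(a_{-i})$, such that: 1. for every sequence $\mathfrak A$ and every $i\in\mathbb Z$, the lattice $\Gamma_i$ with generating matrix $\begin{pmatrix}1&-\Delta_i\\1&-\widetilde\Delta_i\end{pmatrix}$ is an irrational lattice whose NBA-equivalence class corresponds to the class of $\mathfrak A$; 2. whenever the class of an irrational lattice $\Lambda$ corresponds to the class of $\mathfrak A$, $\operatorname{disp}(\Lambda)/\det(\Lambda)=\operatorname{disp}(\mathfrak A)$. In particular $\operatorname{disp}(\Gamma_i)/\det(\Gamma_i)=\operatorname{disp}(\mathfrak A)$ for every $i\in\mathbb Z$. -/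

import Mathlib

open MeasureTheory Filter Topology
open scoped ENNReal

namespace NBA

/-! ### Matrices: generated subgroups and NBA equivalence -/

/-- The subgroup of `ℝ²` generated by the columns of `A`. -/
def colSpan (A : Matrix (Fin 2) (Fin 2) ℝ) : Submodule ℤ (Fin 2 → ℝ) :=
  Submodule.span ℤ (Set.range A.col)

/-- `A` is a generating matrix of the (full rank) lattice `L`: its columns form a `ℤ`-basis. -/
def Generates (A : Matrix (Fin 2) (Fin 2) ℝ) (L : Submodule ℤ (Fin 2 → ℝ)) : Prop :=
  A.det ≠ 0 ∧ colSpan A = L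

/-- The elementary operations on matrices: left multiplication by `diag(a, b)` with `ab ≠ 0`,
left multiplication by the coordinate swap, right multiplication by an element of `GL₂(ℤ)`. -/
inductive Step : Matrix (Fin 2) (Fin 2) ℝ → Matrix (Fin 2) (Fin 2) ℝ → Prop
  | diag (A : Matrix (Fin 2) (Fin 2) ℝ) (a b : ℝ) (h : a * b ≠ 0) :
      Step A (Matrix.diagonal ![a, b] * A)
  | swap (A : Matrix (Fin 2) (Fin 2) ℝ) : Step A (!![0, 1; 1, 0] * A)
  | right (A : Matrix (Fin 2) (Fin 2) ℝ) (U : GL (Fin 2) ℤ) :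
      Step A (A * (U : Matrix (Fin 2) (Fin 2) ℤ).map (fun z : ℤ => (z : ℝ)))

/-- NBA (normalized box area) equivalence of matrices: the equivalence relation generated by
the elementary operations. -/
def MatEquiv : Matrix (Fin 2) (Fin 2) ℝ → Matrix (Fin 2) (Fin 2) ℝ → Prop :=
  Relation.EqvGen Step

theorem exists_int_mul_of_colSpan_le {A B : Matrix (Fin 2) (Fin 2) ℝ}
    (h : colSpan B ≤ colSpan A) :
    ∃ P : Matrix (Fin 2) (Fin 2) ℤ, B = A * P.map (fun z : ℤ => (z : ℝ)) := by
  have h1 : ∀ j, ∃ c : Fin 2 → ℤ, ∑ i, c i • A.col i = B.col j := fun j =>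
    (Submodule.mem_span_range_iff_exists_fun ℤ).1
      (h (Submodule.subset_span (Set.mem_range_self j)))
  choose c hc using h1
  refine ⟨Matrix.of fun i j => c j i, ?_⟩
  ext i j
  have := congrFun (hc j) i
  simp only [Finset.sum_apply, Matrix.col_apply, zsmul_eq_mul] at this
  rw [← this, Matrix.mul_apply]
  exact Finset.sum_congr rfl fun k _ => by simp [mul_comm]

/-- Two generating matrices of the same lattice differ by an element of `GL₂(ℤ)`. -/
theorem matEquiv_of_generates {A B : Matrix (Fin 2) (Fin 2) ℝ}
    {L : Submodule ℤ (Fin 2 → ℝ)} (hA : Generates A L) (hB : Generates B L) :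
    MatEquiv A B := by
  obtain ⟨P, hP⟩ := exists_int_mul_of_colSpan_le (A := A) (B := B) (by rw [hA.2, hB.2])
  obtain ⟨Q, hQ⟩ := exists_int_mul_of_colSpan_le (A := B) (B := A) (by rw [hA.2, hB.2])
  have hd : ((P.det * Q.det : ℤ) : ℝ) = 1 := by
    have hm : ∀ M : Matrix (Fin 2) (Fin 2) ℤ,
        (M.map (fun z : ℤ => (z : ℝ))).det = (M.det : ℝ) := fun M => by
      simp [Matrix.det_fin_two]
    have e : A.det = A.det * (P.det * Q.det) := by
      conv_lhs => rw [hQ, hP, Matrix.det_mul, Matrix.det_mul, hm, hm]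
      ring
    rw [Int.cast_mul]
    exact mul_left_cancel₀ hA.1 (by rw [← e, mul_one])
  have hu : IsUnit P := by
    rw [Matrix.isUnit_iff_isUnit_det]
    exact IsUnit.of_mul_eq_one _ (by exact_mod_cast hd)
  obtain ⟨U, rfl⟩ := hu
  rw [hP]
  exact Relation.EqvGen.rel _ _ (Step.right A U)

/-! ### Irrational lattices -/

/-- An irrational lattice: a full rank lattice in `ℝ²` no two of whose points lie on a common
vertical or horizontal line. -/
structure IrrationalLattice where
  carrier : Submodule ℤ (Fin 2 → ℝ)
  [discrete : DiscreteTopology carrier]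
  [isZLattice : IsZLattice ℝ carrier]
  irrational : ∀ x ∈ carrier, ∀ y ∈ carrier, ∀ i, x i = y i → x = y

attribute [instance] IrrationalLattice.discrete IrrationalLattice.isZLattice

theorem IrrationalLattice.exists_generates (L : IrrationalLattice) :
    ∃ A, Generates A L.carrier := by
  have hr : Fintype.card (Module.Free.ChooseBasisIndex ℤ L.carrier) = Fintype.card (Fin 2) := by
    rw [← Module.finrank_eq_card_chooseBasisIndex, ZLattice.rank ℝ L.carrier]
    simp
  let b : Module.Basis (Fin 2) ℤ L.carrier :=
    (Module.Free.chooseBasis ℤ L.carrier).reindex (Fintype.equivOfCardEq hr)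
  let B := b.ofZLatticeBasis ℝ L.carrier
  have hc : (Matrix.of fun i j => B j i).col = B := rfl
  refine ⟨Matrix.of fun i j => B j i, ?_, ?_⟩
  · rw [← isUnit_iff_ne_zero, ← Matrix.isUnit_iff_isUnit_det,
      ← Matrix.linearIndependent_cols_iff_isUnit, hc]
    exact B.linearIndependent
  · rw [colSpan, hc]
    exact b.ofZLatticeBasis_span ℝ L.carrier

/-- NBA equivalence of irrational lattices: NBA equivalence of generating matrices. -/
instance latticeSetoid : Setoid IrrationalLattice where
  r L M := ∃ A B, Generates A L.carrier ∧ Generates B M.carrier ∧ MatEquiv A B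
  iseqv :=
    { refl := fun L => by
        obtain ⟨A, hA⟩ := L.exists_generates
        exact ⟨A, A, hA, hA, Relation.EqvGen.refl A⟩
      symm := fun ⟨A, B, hA, hB, h⟩ => ⟨B, A, hB, hA, Relation.EqvGen.symm _ _ h⟩
      trans := fun ⟨A, B, hA, hB, h⟩ ⟨C, D, hC, hD, h'⟩ =>
        ⟨A, D, hA, hD, Relation.EqvGen.trans _ _ _ h
          (Relation.EqvGen.trans _ _ _ (matEquiv_of_generates hB hC) h')⟩ }

/-! ### Dispersion of lattices -/

/-- The open axis-parallel box `(u₀, v₀) × (u₁, v₁)`. -/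
def box (u v : Fin 2 → ℝ) : Set (Fin 2 → ℝ) :=
  Set.pi Set.univ fun i => Set.Ioo (u i) (v i)

/-- The dispersion (possibly infinite): the supremum of the areas of the axis-parallel open boxes
that contain no lattice point. -/
noncomputable def disp (L : IrrationalLattice) : ℝ≥0∞ :=
  ⨆ (u : Fin 2 → ℝ) (v : Fin 2 → ℝ) (_ : Disjoint (box u v) (L.carrier : Set (Fin 2 → ℝ))),
    volume (box u v)

/-- The dispersion divided by the determinant (covolume) of the lattice. -/
noncomputable def normDisp (L : IrrationalLattice) : ℝ≥0∞ :=
  disp L / ENNReal.ofReal (ZLattice.covolume L.carrier)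

/-! ### Two-sided sequences and continued fractions -/

/-- Two-sided sequences are identified if they agree up to a shift, or up to a reversal followed
by a shift. -/
instance seqSetoid : Setoid (ℤ → ℕ+) where
  r a b := (∃ k : ℤ, ∀ i, b i = a (i + k)) ∨ (∃ k : ℤ, ∀ i, b i = a (k - i))
  iseqv :=
    { refl := fun a => Or.inl ⟨0, fun i => by simp⟩
      symm := by
        rintro a b (⟨k, h⟩ | ⟨k, h⟩)
        · exact Or.inl ⟨-k, fun i => by simp [h]⟩
        · exact Or.inr ⟨k, fun i => by simp [h]⟩
      trans := by
        rintro a b c (⟨k, h⟩ | ⟨k, h⟩) (⟨l, h'⟩ | ⟨l, h'⟩)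
        · exact Or.inl ⟨l + k, fun i => by rw [h', h, add_assoc]⟩
        · exact Or.inr ⟨l + k, fun i => by rw [h', h]; congr 1; ring⟩
        · exact Or.inr ⟨k - l, fun i => by rw [h', h]; congr 1; ring⟩
        · exact Or.inl ⟨k - l, fun i => by rw [h', h]; congr 1; ring⟩ }

/-- The infinite simple continued fraction with partial quotients `a 0, a 1, a 2, …`. -/
def contFrac (a : ℕ → ℕ+) : GenContFract ℝ :=
  ⟨(a 0 : ℕ), Stream'.Seq.ofStream fun n => ⟨1, ((a (n + 1) : ℕ) : ℝ)⟩⟩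

/-- The value `[a 0, a 1, a 2, …]`: the limit of the finite continued fractions
`[a 0, …, a n]`. -/
noncomputable def cfValue (a : ℕ → ℕ+) : ℝ :=
  limUnder atTop (contFrac a).convs'

theorem convs'_zero (a : ℕ → ℕ+) : (contFrac a).convs' 0 = (a 0 : ℕ) := by
  simp [GenContFract.convs', GenContFract.convs'Aux, contFrac]

theorem convs'_succ (a : ℕ → ℕ+) (n : ℕ) :
    (contFrac a).convs' (n + 1) = (a 0 : ℕ) + 1 / (contFrac fun k => a (k + 1)).convs' n := by
  have h : (Stream'.Seq.ofStream fun n => (⟨1, ((a (n + 1) : ℕ) : ℝ)⟩ : GenContFract.Pair ℝ)).head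
      = some ⟨1, ((a 1 : ℕ) : ℝ)⟩ := rfl
  have ht : (Stream'.Seq.ofStream fun n => (⟨1, ((a (n + 1) : ℕ) : ℝ)⟩ : GenContFract.Pair ℝ)).tail
      = Stream'.Seq.ofStream fun n => ⟨1, ((a (n + 1 + 1) : ℕ) : ℝ)⟩ := rfl
  simp only [GenContFract.convs', GenContFract.convs'Aux, contFrac, h, ht, zero_add]


/-- The finite continued fractions do converge to `cfValue a`. -/
theorem tendsto_cfValue (a : ℕ → ℕ+) :
    Tendsto (contFrac a).convs' atTop (𝓝 (cfValue a)) := by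
  have hp : ∀ a : ℕ → ℕ+, (1 : ℝ) ≤ (a 0 : ℕ) := fun a => by exact_mod_cast (a 0).pos
  have hge : ∀ n (a : ℕ → ℕ+), ((a 0 : ℕ) : ℝ) ≤ (contFrac a).convs' n ∧
      (contFrac a).convs' n ≤ (a 0 : ℕ) + 1 := by
    intro n
    induction n with
    | zero => intro a; rw [convs'_zero]; constructor <;> linarith
    | succ n ih =>
      intro a
      have h1 := (hp fun k => a (k + 1)).trans (ih fun k => a (k + 1)).1
      have h2 : 1 / (contFrac fun k => a (k + 1)).convs' n ≤ 1 :=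
        (div_le_one (by linarith)).2 h1
      have h3 : 0 ≤ 1 / (contFrac fun k => a (k + 1)).convs' n := by positivity
      rw [convs'_succ]
      constructor <;> linarith
  have key : ∀ (k n m : ℕ) (a : ℕ → ℕ+),
      |(contFrac a).convs' (n + 2 * k) - (contFrac a).convs' (m + 2 * k)| ≤ (1 / 4) ^ k := by
    intro k
    induction k with
    | zero =>
      intro n m a
      have h1 := hge n a
      have h2 := hge m a
      simp only [mul_zero, add_zero, pow_zero, abs_le]
      constructor <;> linarith
    | succ k ih =>
      intro n m a
      have h := ih n m fun j => a (j + 1 + 1)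
      have hx := (hp fun j => a (j + 1 + 1)).trans (hge (n + 2 * k) fun j => a (j + 1 + 1)).1
      have hy := (hp fun j => a (j + 1 + 1)).trans (hge (m + 2 * k) fun j => a (j + 1 + 1)).1
      have hb := hp fun j => a (j + 1)
      rw [show n + 2 * (k + 1) = n + 2 * k + 1 + 1 by ring,
        show m + 2 * (k + 1) = m + 2 * k + 1 + 1 by ring,
        convs'_succ, convs'_succ, convs'_succ, convs'_succ]
      generalize (contFrac fun j => a (j + 1 + 1)).convs' (n + 2 * k) = x at *
      generalize (contFrac fun j => a (j + 1 + 1)).convs' (m + 2 * k) = y at *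
      simp only [zero_add] at hb ⊢
      generalize (((a 1 : ℕ+) : ℕ) : ℝ) = b at *
      have e : ((a 0 : ℕ) : ℝ) + 1 / (b + 1 / x) - ((a 0 : ℕ) + 1 / (b + 1 / y))
          = (x - y) / ((b * x + 1) * (b * y + 1)) := by
        have : b * x + 1 ≠ 0 := by positivity
        have : b * y + 1 ≠ 0 := by positivity
        have : x ≠ 0 := by positivity
        have : y ≠ 0 := by positivity
        field_simp
        ring
      have h4 : (4 : ℝ) ≤ (b * x + 1) * (b * y + 1) := by
        have : 1 ≤ b * x := by nlinarith
        have : 1 ≤ b * y := by nlinarith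
        nlinarith
      rw [e, abs_div, abs_of_pos (by linarith : 0 < (b * x + 1) * (b * y + 1)), pow_succ]
      rw [div_le_iff₀ (by linarith)]
      have : (0 : ℝ) ≤ (1 / 4) ^ k := by positivity
      nlinarith
  have hc : CauchySeq (contFrac a).convs' := by
    rw [Metric.cauchySeq_iff']
    intro ε hε
    obtain ⟨k, hk⟩ := exists_pow_lt_of_lt_one hε (by norm_num : (1 / 4 : ℝ) < 1)
    refine ⟨2 * k, fun n hn => ?_⟩
    have := key k (n - 2 * k) 0 a
    rw [Nat.sub_add_cancel hn, zero_add] at this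
    exact lt_of_le_of_lt this hk
  exact hc.tendsto_limUnder

/-- `Δ_i = [a_i, a_{i+1}, a_{i+2}, …]`. -/
noncomputable def Δ (a : ℤ → ℕ+) (i : ℤ) : ℝ :=
  cfValue fun n => a (i + n)

/-- `Δ̃_i = -[0, a_{i-1}, a_{i-2}, …] = -1 / [a_{i-1}, a_{i-2}, …]`. -/
noncomputable def Δ' (a : ℤ → ℕ+) (i : ℤ) : ℝ :=
  -(1 / cfValue fun n => a (i - 1 - n))

/-- The generating matrix attached to the two-sided sequence `a` with base point `i`. -/
noncomputable def seqMatrix (a : ℤ → ℕ+) (i : ℤ) : Matrix (Fin 2) (Fin 2) ℝ :=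
  !![1, -Δ a i; 1, -Δ' a i]

/-- The (possibly infinite) dispersion of a two-sided sequence. -/
noncomputable def seqDisp (a : ℤ → ℕ+) : ℝ≥0∞ :=
  ⨆ (i : ℤ) (j : Fin (a i)),
    ENNReal.ofReal ((1 - (j : ℕ) + Δ a i) * (1 + (j : ℕ) - Δ' a i) / (Δ a i - Δ' a i))

end NBA

/-! Let p_i = (x_i, y_i) be the vectors with p_0 = (1, 1) and p_{i-1} = (-Δ_i x_i, -Δ̃_i y_i). Both
z = Δ and z = Δ̃ satisfy z_i = a_i + 1/z_{i+1}, so p_{i+1} = p_{i-1} + a_i p_i, and any two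
consecutive p_i form a basis of the lattice of the sequence. Along this chain |x_i| falls and y_i
grows. The box |X| < |x_{i-1}|, |Y| < y_i contains no nonzero lattice point
(`IsChain.eq_zero_of_abs_lt`), so the ±p_i are exactly the minimal vectors (`IsChain.minVec_iff`).

Injectivity: generating matrices of NBA-equivalent lattices differ by scaling and permuting
coordinates, up to a change of basis. This preserves minimal vectors and keeps or reverses their
order, and a_i is |det(p_{i-1}, p_{i+1})| divided by the covolume. Hence the sequence is recovered
up to shift and reversal (`seq_equiv_of_similar`).

Surjectivity: an irrational lattice has a basis which scales to (1, 1), (-s, t) with s > 1 > t > 0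
irrational; expanding s and 1/t gives the two halves of the sequence (`exists_seqLattice_equiv`).

Dispersion: for 0 ≤ j < a_i the box whose sides pass through 0, p_i, p_{i-1} + j p_i and p_{i-1} +
(j+1) p_i is empty (`le_matDisp_seqMatrix`). Conversely, the basis p_i, p_{i-1} + j p_i forces a
lattice point into every box that is too large, so each empty box of positive height is at most as
wide and as high as one of these (`IsChain.exists_dim_le`). -/

namespace NBA

/-! ### Continued fraction values -/

theorem le_convs' (n : ℕ) (a : ℕ → ℕ+) : ((a 0 : ℕ) : ℝ) ≤ (contFrac a).convs' n := by
  induction n generalizing a with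
  | zero => rw [convs'_zero]
  | succ n ih =>
    have h := (Nat.cast_nonneg (α := ℝ) _).trans (ih fun k => a (k + 1))
    rw [convs'_succ]
    have : 0 ≤ 1 / (contFrac fun k => a (k + 1)).convs' n := by positivity
    linarith

theorem one_le_pnat_cast (n : ℕ+) : (1 : ℝ) ≤ (n : ℕ) := by exact_mod_cast n.pos

theorem one_le_cfValue (a : ℕ → ℕ+) : 1 ≤ cfValue a :=
  (one_le_pnat_cast (a 0)).trans (ge_of_tendsto' (tendsto_cfValue a) fun n => le_convs' n a)

theorem cfValue_eq (a : ℕ → ℕ+) :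
    cfValue a = (a 0 : ℕ) + 1 / cfValue fun k => a (k + 1) := by
  have h1 := (tendsto_cfValue a).comp (tendsto_add_atTop_nat 1)
  have h0 : cfValue (fun k => a (k + 1)) ≠ 0 :=
    (zero_lt_one.trans_le (one_le_cfValue _)).ne'
  have h2 := (tendsto_const_nhds (x := (1 : ℝ))).div (tendsto_cfValue fun k => a (k + 1)) h0
  refine tendsto_nhds_unique h1 ((h2.const_add ((a 0 : ℕ) : ℝ)).congr fun n => ?_)
  exact (convs'_succ a n).symm

theorem lt_cfValue (a : ℕ → ℕ+) : ((a 0 : ℕ) : ℝ) < cfValue a := by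
  have := one_le_cfValue fun k => a (k + 1)
  rw [cfValue_eq]
  have : 0 < 1 / cfValue fun k => a (k + 1) := by positivity
  linarith

theorem one_lt_cfValue (a : ℕ → ℕ+) : 1 < cfValue a :=
  (one_le_pnat_cast (a 0)).trans_lt (lt_cfValue a)

/-- Infinite descent on the denominator: if the value is p/q, its tail is q/r with 0 < r = p - a₀q <
q. -/
theorem cfValue_mul_natCast_ne_intCast (q : ℕ) (a : ℕ → ℕ+) (p : ℤ) (hq : 0 < q) :
    cfValue a * q ≠ p := by
  induction q using Nat.strong_induction_on generalizing a p with
  | _ q ih =>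
    intro h
    have hx := one_lt_cfValue fun k => a (k + 1)
    have e := cfValue_eq a
    set x := cfValue fun k => a (k + 1) with hx'
    have hq' : (0 : ℝ) < q := by exact_mod_cast hq
    have e1 : ((p - (a 0 : ℕ) * q : ℤ) : ℝ) = q / x := by
      push_cast
      rw [← h, e]
      ring
    have h2 : (0 : ℝ) < ((p - (a 0 : ℕ) * q : ℤ) : ℝ) := by rw [e1]; positivity
    have h3 : ((p - (a 0 : ℕ) * q : ℤ) : ℝ) < q := by
      rw [e1]; exact div_lt_self hq' hx
    obtain ⟨r, hr⟩ := Int.eq_ofNat_of_zero_le (a := p - (a 0 : ℕ) * q)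
      (by exact_mod_cast h2.le)
    rw [hr] at e1 h2 h3
    have hr0 : 0 < r := by exact_mod_cast h2
    refine ih r (by exact_mod_cast h3) (fun k => a (k + 1)) q hr0 ?_
    have : x ≠ 0 := by positivity
    rw [← hx']
    have e2 : (r : ℝ) = q / x := by exact_mod_cast e1
    rw [e2]
    push_cast
    field_simp

theorem irrational_cfValue (a : ℕ → ℕ+) : Irrational (cfValue a) := by
  rintro ⟨r, hr⟩
  refine cfValue_mul_natCast_ne_intCast r.den a r.num r.den_pos ?_
  rw [← hr]
  exact_mod_cast Rat.mul_den_eq_num r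

/-- The recurrence determines the value of a continued fraction. -/
theorem eq_cfValue_of_recurrence {x : ℕ → ℝ} {a : ℕ → ℕ+} (hx : ∀ n, 1 ≤ x n)
    (h : ∀ n, x n = (a n : ℕ) + 1 / x (n + 1)) : x 0 = cfValue a := by
  -- Two steps of the recurrence divide distances by (bu + 1)(bv + 1) ≥ 4. A single step need not
  -- contract uniformly, since its factor 1/(uv) can be close to 1.
  have key : ∀ (k : ℕ) (x : ℕ → ℝ) (a : ℕ → ℕ+), (∀ n, 1 ≤ x n) →
      (∀ n, x n = (a n : ℕ) + 1 / x (n + 1)) → |x 0 - cfValue a| ≤ (1 / 4) ^ k := by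
    intro k
    induction k with
    | zero =>
      intro x a hx h
      have h0 := h 0
      have h1 := cfValue_eq a
      have h2 := hx 1
      have h3 := one_le_cfValue fun k => a (k + 1)
      have h4 : 1 / x 1 ≤ 1 := (div_le_one (by linarith)).2 h2
      have h5 : 1 / (cfValue fun k => a (k + 1)) ≤ 1 := (div_le_one (by linarith)).2 h3
      have h6 : 0 ≤ 1 / x 1 := by positivity
      have h7 : 0 ≤ 1 / (cfValue fun k => a (k + 1)) := by positivity
      rw [zero_add] at h0
      rw [pow_zero, abs_le]
      constructor <;> linarith
    | succ k ih =>
      intro x a hx h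
      have hk := ih (fun n => x (n + 2)) (fun n => a (n + 2)) (fun n => hx _) fun n => h _
      have e1 : x 0 = (a 0 : ℕ) + 1 / ((a 1 : ℕ) + 1 / x 2) := by rw [← h 1, ← h 0]
      have e2 : cfValue a
          = (a 0 : ℕ) + 1 / ((a 1 : ℕ) + 1 / cfValue fun k => a (k + 2)) := by
        rw [cfValue_eq a, cfValue_eq fun k => a (k + 1)]
      have hu := hx 2
      have hv := one_le_cfValue fun k => a (k + 2)
      have hb := one_le_pnat_cast (a 1)
      rw [e1, e2]
      simp only [zero_add] at hk
      generalize (cfValue fun k => a (k + 2)) = v at *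
      generalize x 2 = u at *
      generalize (((a 1 : ℕ+) : ℕ) : ℝ) = b at *
      have e : ((a 0 : ℕ) : ℝ) + 1 / (b + 1 / u) - ((a 0 : ℕ) + 1 / (b + 1 / v))
          = (u - v) / ((b * u + 1) * (b * v + 1)) := by
        have : b * u + 1 ≠ 0 := by positivity
        have : b * v + 1 ≠ 0 := by positivity
        have : u ≠ 0 := by positivity
        have : v ≠ 0 := by positivity
        field_simp
        ring
      have h4 : (4 : ℝ) ≤ (b * u + 1) * (b * v + 1) := by
        have : 1 ≤ b * u := by nlinarith
        have : 1 ≤ b * v := by nlinarith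
        nlinarith
      rw [e, abs_div, abs_of_pos (by linarith : 0 < (b * u + 1) * (b * v + 1)), pow_succ]
      rw [div_le_iff₀ (by linarith)]
      have : (0 : ℝ) ≤ (1 / 4) ^ k := by positivity
      nlinarith
  have h0 : |x 0 - cfValue a| ≤ 0 :=
    ge_of_tendsto' (tendsto_pow_atTop_nhds_zero_of_lt_one (by norm_num) (by norm_num))
      fun k => key k x a hx h
  exact sub_eq_zero.1 (abs_nonpos_iff.1 h0)

theorem Irrational.one_lt_inv_fract {x : ℝ} (hx : Irrational x) : 1 < (Int.fract x)⁻¹ := by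
  have h0 : 0 < Int.fract x := Int.fract_pos.2 fun h => hx ⟨⌊x⌋, by rw [Rat.cast_intCast]; exact h.symm⟩
  exact (one_lt_inv₀ h0).2 (Int.fract_lt_one x)

theorem Irrational.inv_fract {x : ℝ} (hx : Irrational x) : Irrational (Int.fract x)⁻¹ :=
  (hx.sub_intCast ⌊x⌋).inv

/-- Every irrational number above `1` is the value of an infinite continued fraction. -/
theorem exists_cfValue_eq {x : ℝ} (hx : Irrational x) (h1 : 1 < x) :
    ∃ a : ℕ → ℕ+, cfValue a = x := by
  -- The complete quotients, that is, the orbit of x under y ↦ 1/{y}; their floors are the partial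
  -- quotients.
  let X : ℕ → ℝ := fun n => (fun y => (Int.fract y)⁻¹)^[n] x
  have hs : ∀ n, X (n + 1) = (Int.fract (X n))⁻¹ := fun n => by
    simp only [X, Function.iterate_succ_apply']
  have hX : ∀ n, Irrational (X n) ∧ 1 < X n := by
    intro n
    induction n with
    | zero => exact ⟨hx, h1⟩
    | succ n ih => rw [hs]; exact ⟨Irrational.inv_fract ih.1, Irrational.one_lt_inv_fract ih.1⟩
  have hpos : ∀ n, 0 < ⌊X n⌋₊ := fun n => Nat.floor_pos.2 (hX n).2.le
  refine ⟨fun n => ⟨⌊X n⌋₊, hpos n⟩, ?_⟩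
  refine (eq_cfValue_of_recurrence (x := X) (fun n => (hX n).2.le) fun n => ?_).symm
  have h0 : (0 : ℝ) ≤ X n := by linarith [(hX n).2]
  rw [hs, one_div, inv_inv, PNat.mk_coe, natCast_floor_eq_intCast_floor h0]
  exact (Int.floor_add_fract _).symm

/-! ### The two ends of a two-sided sequence -/

theorem Δ_eq (a : ℤ → ℕ+) (i : ℤ) : Δ a i = (a i : ℕ) + 1 / Δ a (i + 1) := by
  rw [Δ, cfValue_eq, Δ]
  simp only [Nat.cast_zero, add_zero, Nat.cast_add, Nat.cast_one]
  congr 4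
  funext n
  congr 1
  ring

/-- Equivalently Δ̃_i = a_i + 1/Δ̃_{i+1}: both ends obey the same recurrence, which is why one
integer matrix moves both rows of the generating matrix. -/
theorem neg_inv_Δ' (a : ℤ → ℕ+) (i : ℤ) : -(Δ' a (i + 1))⁻¹ = (a i : ℕ) - Δ' a i := by
  rw [Δ', Δ', ← inv_neg, neg_neg, one_div, inv_inv, cfValue_eq]
  simp only [Nat.cast_zero, sub_zero, Nat.cast_add, Nat.cast_one, add_sub_cancel_right, sub_neg_eq_add]
  congr 4
  funext n
  congr 1
  ring

theorem one_lt_Δ (a : ℤ → ℕ+) (i : ℤ) : 1 < Δ a i := one_lt_cfValue _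

theorem lt_Δ (a : ℤ → ℕ+) (i : ℤ) : ((a i : ℕ) : ℝ) < Δ a i := by
  simpa [Δ] using lt_cfValue fun n : ℕ => a (i + n)

theorem Δ'_neg (a : ℤ → ℕ+) (i : ℤ) : Δ' a i < 0 := by
  have := one_lt_cfValue fun n : ℕ => a (i - 1 - n)
  rw [Δ', neg_lt_zero]
  positivity

theorem neg_one_lt_Δ' (a : ℤ → ℕ+) (i : ℤ) : -1 < Δ' a i := by
  have := one_lt_cfValue fun n : ℕ => a (i - 1 - n)
  rw [Δ', neg_lt_neg_iff, div_lt_one (by linarith)]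
  exact this

theorem irrational_Δ (a : ℤ → ℕ+) (i : ℤ) : Irrational (Δ a i) := irrational_cfValue _

theorem irrational_Δ' (a : ℤ → ℕ+) (i : ℤ) : Irrational (Δ' a i) := by
  rw [Δ', one_div]
  exact (irrational_cfValue _).inv.neg

theorem Δ_shift (a : ℤ → ℕ+) (k i : ℤ) : Δ (fun j => a (j + k)) i = Δ a (i + k) := by
  unfold Δ
  congr 1; funext n; ring_nf

theorem Δ'_shift (a : ℤ → ℕ+) (k i : ℤ) : Δ' (fun j => a (j + k)) i = Δ' a (i + k) := by
  unfold Δ'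
  congr 3; funext n; ring_nf

theorem Δ_reverse (a : ℤ → ℕ+) (k : ℤ) :
    Δ (fun j => a (k - j)) 0 = -(Δ' a (k + 1))⁻¹ := by
  unfold Δ Δ'
  rw [← inv_neg, neg_neg, one_div, inv_inv]
  congr 1; funext n; ring_nf

theorem Δ'_reverse (a : ℤ → ℕ+) (k : ℤ) :
    Δ' (fun j => a (k - j)) 0 = -(Δ a (k + 1))⁻¹ := by
  unfold Δ Δ'
  rw [one_div]
  congr 3; funext n; ring_nf


/-! ### Lattices given by matrices -/

theorem mem_colSpan {A : Matrix (Fin 2) (Fin 2) ℝ} {p : Fin 2 → ℝ} :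
    p ∈ colSpan A ↔ ∃ m n : ℤ, ∀ k, p k = m * A k 0 + n * A k 1 := by
  rw [colSpan, Submodule.mem_span_range_iff_exists_fun]
  constructor
  · rintro ⟨c, rfl⟩
    exact ⟨c 0, c 1, fun k => by simp⟩
  · rintro ⟨m, n, h⟩
    refine ⟨![m, n], ?_⟩
    ext k
    simp [h]

/-- The basis of `ℝ²` given by the columns of an invertible matrix. -/
noncomputable def colBasis (A : Matrix (Fin 2) (Fin 2) ℝ) (hA : A.det ≠ 0) :
    Module.Basis (Fin 2) ℝ (Fin 2 → ℝ) :=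
  basisOfLinearIndependentOfCardEqFinrank
    (Matrix.linearIndependent_cols_iff_isUnit.2
      ((Matrix.isUnit_iff_isUnit_det A).2 (isUnit_iff_ne_zero.2 hA))) (by simp)

theorem coe_colBasis (A : Matrix (Fin 2) (Fin 2) ℝ) (hA : A.det ≠ 0) :
    ⇑(colBasis A hA) = A.col :=
  coe_basisOfLinearIndependentOfCardEqFinrank _ _

theorem colSpan_eq (A : Matrix (Fin 2) (Fin 2) ℝ) (hA : A.det ≠ 0) :
    colSpan A = Submodule.span ℤ (Set.range (colBasis A hA)) := by
  rw [coe_colBasis, colSpan]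

theorem discreteTopology_colSpan (A : Matrix (Fin 2) (Fin 2) ℝ) (hA : A.det ≠ 0) :
    DiscreteTopology (colSpan A) := by
  rw [colSpan_eq A hA]
  infer_instance

/-- The irrational lattice generated by a matrix whose rows have rationally independent entries. -/
noncomputable def latticeOfMatrix (A : Matrix (Fin 2) (Fin 2) ℝ) (hA : A.det ≠ 0)
    (h : ∀ (m n : ℤ) (k : Fin 2), m * A k 0 + n * A k 1 = 0 → m = 0 ∧ n = 0) :
    IrrationalLattice where
  carrier := colSpan A
  discrete := discreteTopology_colSpan A hA
  isZLattice :=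
    have := discreteTopology_colSpan A hA
    { span_top := by
        rw [colSpan_eq A hA]
        exact ZSpan.span_top _ }
  irrational := fun x hx y hy i hi => by
    obtain ⟨m, n, hmn⟩ := mem_colSpan.1 ((colSpan A).sub_mem hx hy)
    obtain ⟨rfl, rfl⟩ := h m n i (by rw [← hmn i, Pi.sub_apply, hi, sub_self])
    refine sub_eq_zero.1 (funext fun k => ?_)
    rw [hmn]
    simp

theorem generates_latticeOfMatrix (A : Matrix (Fin 2) (Fin 2) ℝ) (hA : A.det ≠ 0)
    (h : ∀ (m n : ℤ) (k : Fin 2), m * A k 0 + n * A k 1 = 0 → m = 0 ∧ n = 0) :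
    Generates A (latticeOfMatrix A hA h).carrier :=
  ⟨hA, rfl⟩

theorem covolume_colSpan {A : Matrix (Fin 2) (Fin 2) ℝ} {L : IrrationalLattice}
    (hA : Generates A L.carrier) : ZLattice.covolume L.carrier = |A.det| := by
  have hsp : Submodule.span ℤ (Set.range A.col) = L.carrier := hA.2
  have hli : LinearIndependent ℤ A.col := by
    have := (colBasis A hA.1).linearIndependent
    rw [coe_colBasis] at this
    exact this.restrict_scalars' ℤ
  let b : Module.Basis (Fin 2) ℤ L.carrier :=
    (Module.Basis.span hli).map (LinearEquiv.ofEq _ _ hsp)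
  rw [ZLattice.covolume_eq_det L.carrier b]
  have : Matrix.of (((↑) : L.carrier → (Fin 2 → ℝ)) ∘ b) = A.transpose := by
    ext i j
    have : (b i : Fin 2 → ℝ) = A.col i :=
      congrArg Subtype.val (Module.Basis.span_apply hli i)
    simp [this]
  rw [this, Matrix.det_transpose]

/-! ### Coordinatewise similarity of matrices -/

/-- The lattice of `B` is carried to that of `A` by scaling and possibly permuting the
coordinates. -/
def Similar (A B : Matrix (Fin 2) (Fin 2) ℝ) : Prop :=
  ∃ (c : Fin 2 → ℝ) (σ : Equiv.Perm (Fin 2)), (∀ i, c i ≠ 0) ∧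
    (∀ x, x ∈ colSpan B ↔ (fun i => c i * x (σ i)) ∈ colSpan A) ∧ |A.det| = |∏ i, c i| * |B.det|

theorem Similar.refl (A : Matrix (Fin 2) (Fin 2) ℝ) : Similar A A :=
  ⟨1, 1, by simp, by simp, by simp⟩

theorem Similar.symm {A B : Matrix (Fin 2) (Fin 2) ℝ} : Similar A B → Similar B A := by
  rintro ⟨c, σ, hc, h, hd⟩
  refine ⟨fun i => (c (σ.symm i))⁻¹, σ.symm, fun i => inv_ne_zero (hc _), fun x => ?_, ?_⟩
  · rw [h]
    simp [hc]
  · have h0 : |∏ i, c i| ≠ 0 := abs_ne_zero.2 (Finset.prod_ne_zero_iff.2 fun i _ => hc i)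
    rw [Equiv.prod_comp σ.symm fun i => (c i)⁻¹, Finset.prod_inv_distrib, abs_inv, hd,
      inv_mul_cancel_left₀ h0]

theorem Similar.trans {A B C : Matrix (Fin 2) (Fin 2) ℝ} :
    Similar A B → Similar B C → Similar A C := by
  rintro ⟨c, σ, hc, h, hd⟩ ⟨c', σ', hc', h', hd'⟩
  refine ⟨fun i => c i * c' (σ i), σ.trans σ', fun i => mul_ne_zero (hc _) (hc' _),
    fun x => ?_, ?_⟩
  · rw [h', h]
    simp [mul_assoc]
  · rw [hd, hd', Finset.prod_mul_distrib, Equiv.prod_comp σ, abs_mul, mul_assoc]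

theorem similar_diagonal (A : Matrix (Fin 2) (Fin 2) ℝ) {a b : ℝ} (h : a * b ≠ 0) :
    Similar (Matrix.diagonal ![a, b] * A) A := by
  have h' := mul_ne_zero_iff.1 h
  refine ⟨![a, b], 1, ?_, fun x => ?_, ?_⟩
  · simp [Fin.forall_fin_two, h'.1, h'.2]
  · simp only [mem_colSpan, Fin.forall_fin_two, Equiv.Perm.coe_one, id, Matrix.diagonal_mul,
      Matrix.cons_val_zero, Matrix.cons_val_one]
    refine exists_congr fun m => exists_congr fun n => and_congr ?_ ?_
    · rw [← mul_right_inj' h'.1]; ring_nf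
    · rw [← mul_right_inj' h'.2]; ring_nf
  · rw [Matrix.det_mul, Matrix.det_diagonal, abs_mul]

theorem similar_swap (A : Matrix (Fin 2) (Fin 2) ℝ) : Similar (!![0, 1; 1, 0] * A) A := by
  refine ⟨1, Equiv.swap 0 1, by simp, fun x => ?_, ?_⟩
  · simp only [mem_colSpan, Fin.forall_fin_two]
    refine exists_congr fun m => exists_congr fun n => ?_
    simp [Matrix.mul_apply, and_comm]
  · rw [Matrix.det_mul]; simp [Matrix.det_fin_two, abs_sub_comm]

theorem colSpan_mul_le (A : Matrix (Fin 2) (Fin 2) ℝ) (P : Matrix (Fin 2) (Fin 2) ℤ) :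
    colSpan (A * P.map fun z : ℤ => (z : ℝ)) ≤ colSpan A := by
  intro x
  simp only [mem_colSpan]
  rintro ⟨m, n, h⟩
  refine ⟨m * P 0 0 + n * P 0 1, m * P 1 0 + n * P 1 1, fun k => ?_⟩
  rw [h]
  simp [Matrix.mul_apply]
  ring

theorem map_mul_map_inv (U : GL (Fin 2) ℤ) :
    (U : Matrix (Fin 2) (Fin 2) ℤ).map (fun z : ℤ => (z : ℝ))
      * ((U⁻¹ : GL (Fin 2) ℤ) : Matrix (Fin 2) (Fin 2) ℤ).map (fun z : ℤ => (z : ℝ)) = 1 := by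
  have := Matrix.map_mul (f := Int.castRingHom ℝ) (L := (U : Matrix (Fin 2) (Fin 2) ℤ))
    (M := ((U⁻¹ : GL (Fin 2) ℤ) : Matrix (Fin 2) (Fin 2) ℤ))
  rw [← Units.val_mul, mul_inv_cancel, Units.val_one] at this
  refine this.symm.trans ?_
  ext i j
  fin_cases i <;> fin_cases j <;> simp

theorem colSpan_mul_unit (A : Matrix (Fin 2) (Fin 2) ℝ) (U : GL (Fin 2) ℤ) :
    colSpan (A * (U : Matrix (Fin 2) (Fin 2) ℤ).map fun z : ℤ => (z : ℝ)) = colSpan A := by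
  refine le_antisymm (colSpan_mul_le _ _) ?_
  have := colSpan_mul_le (A * (U : Matrix (Fin 2) (Fin 2) ℤ).map fun z : ℤ => (z : ℝ))
    ((U⁻¹ : GL (Fin 2) ℤ) : Matrix (Fin 2) (Fin 2) ℤ)
  rwa [mul_assoc, map_mul_map_inv, mul_one] at this

theorem abs_det_mul_unit (A : Matrix (Fin 2) (Fin 2) ℝ) (U : GL (Fin 2) ℤ) :
    |(A * (U : Matrix (Fin 2) (Fin 2) ℤ).map fun z : ℤ => (z : ℝ)).det| = |A.det| := by
  have h : ((U : Matrix (Fin 2) (Fin 2) ℤ).map fun z : ℤ => (z : ℝ)).det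
      = ((U : Matrix (Fin 2) (Fin 2) ℤ).det : ℝ) := by simp [Matrix.det_fin_two]
  have hu : IsUnit (U : Matrix (Fin 2) (Fin 2) ℤ).det :=
    (Matrix.isUnit_iff_isUnit_det _).1 U.isUnit
  rw [Matrix.det_mul, abs_mul, h, ← Int.cast_abs, Int.isUnit_iff_abs_eq.1 hu, Int.cast_one,
    mul_one]

/-- A word of elementary operations collapses to one scaled permutation of the coordinates, because
right multiplication by GL₂(ℤ) changes neither the lattice nor the absolute determinant. -/
theorem similar_of_matEquiv {A B : Matrix (Fin 2) (Fin 2) ℝ} (h : MatEquiv A B) :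
    Similar A B := by
  induction h with
  | rel A B h =>
    cases h with
    | diag a b h => exact (similar_diagonal A h).symm
    | swap => exact (similar_swap A).symm
    | right U =>
      exact ⟨1, 1, by simp, by simp [colSpan_mul_unit], by rw [abs_det_mul_unit]; simp⟩
  | refl A => exact Similar.refl A
  | symm _ _ _ ih => exact ih.symm
  | trans _ _ _ _ _ ih ih' => exact ih.trans ih'

/-- Generating matrices of equivalent lattices are similar. -/
theorem similar_of_equiv {L M : IrrationalLattice} (h : L ≈ M)
    {A B : Matrix (Fin 2) (Fin 2) ℝ} (hA : Generates A L.carrier) (hB : Generates B M.carrier) :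
    Similar A B := by
  obtain ⟨C, D, hC, hD, h⟩ := h
  exact similar_of_matEquiv (Relation.EqvGen.trans _ _ _ (matEquiv_of_generates hA hC)
    (Relation.EqvGen.trans _ _ _ h (matEquiv_of_generates hD hB)))

/-! ### Invariance of the normalized dispersion -/

/-- The dispersion of a matrix divided by its determinant. -/
noncomputable def matDisp (A : Matrix (Fin 2) (Fin 2) ℝ) : ℝ≥0∞ :=
  (⨆ (u : Fin 2 → ℝ) (v : Fin 2 → ℝ)
    (_ : Disjoint (box u v) (colSpan A : Set (Fin 2 → ℝ))), volume (box u v)) /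
      ENNReal.ofReal |A.det|

theorem normDisp_eq_matDisp {A : Matrix (Fin 2) (Fin 2) ℝ} {L : IrrationalLattice}
    (hA : Generates A L.carrier) : normDisp L = matDisp A := by
  rw [normDisp, covolume_colSpan hA, matDisp, disp, hA.2]

theorem volume_box (u v : Fin 2 → ℝ) :
    volume (box u v) = ENNReal.ofReal (v 0 - u 0) * ENNReal.ofReal (v 1 - u 1) := by
  rw [box, Real.volume_pi_Ioo, Fin.prod_univ_two]

theorem mem_box {u v x : Fin 2 → ℝ} : x ∈ box u v ↔ ∀ i, u i < x i ∧ x i < v i := by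
  simp [box]

theorem exists_box_preimage (c : Fin 2 → ℝ) (σ : Equiv.Perm (Fin 2)) (hc : ∀ i, c i ≠ 0)
    (u v : Fin 2 → ℝ) : ∃ u' v', (∀ x, (fun i => c i * x (σ i)) ∈ box u' v' ↔ x ∈ box u v) ∧
      volume (box u' v') = ENNReal.ofReal |∏ i, c i| * volume (box u v) := by
  -- A negative factor reverses an interval, so its endpoints are exchanged.
  refine ⟨fun i => if 0 < c i then c i * u (σ i) else c i * v (σ i),
    fun i => if 0 < c i then c i * v (σ i) else c i * u (σ i), fun x => ?_, ?_⟩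
  · rw [mem_box, mem_box, ← σ.forall_congr_right (q := fun i => u i < x i ∧ x i < v i)]
    refine forall_congr' fun i => ?_
    rcases lt_or_gt_of_ne (hc i) with h | h
    · simp only [if_neg h.not_gt, mul_lt_mul_left_of_neg h]
      exact and_comm
    · simp only [if_pos h, mul_lt_mul_iff_right₀ h]
  · rw [box, box, Real.volume_pi_Ioo, Real.volume_pi_Ioo, Finset.abs_prod,
      ENNReal.ofReal_prod_of_nonneg fun i _ => abs_nonneg _,
      ← Equiv.prod_comp σ fun i => ENNReal.ofReal (v i - u i), ← Finset.prod_mul_distrib]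
    refine Finset.prod_congr rfl fun i _ => ?_
    rw [← ENNReal.ofReal_mul (abs_nonneg _)]
    congr 1
    rcases lt_or_gt_of_ne (hc i) with h | h
    · simp only [if_neg h.not_gt, abs_of_neg h]; ring
    · simp only [if_pos h, abs_of_pos h]; ring

/-- Empty boxes go to empty boxes, and areas and determinants scale by the same factor |∏ c i|. The
reverse inequality follows by symmetry of `Similar`. -/
theorem Similar.matDisp_le {A B : Matrix (Fin 2) (Fin 2) ℝ} (h : Similar A B) :
    matDisp B ≤ matDisp A := by
  obtain ⟨c, σ, hc, h, hd⟩ := h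
  have h0 : 0 < |∏ i, c i| := abs_pos.2 (Finset.prod_ne_zero_iff.2 fun i _ => hc i)
  rw [matDisp, matDisp, hd, ENNReal.ofReal_mul (abs_nonneg _),
    ← ENNReal.mul_div_mul_left _ _ (ENNReal.ofReal_pos.2 h0).ne' ENNReal.ofReal_ne_top]
  gcongr
  simp only [ENNReal.mul_iSup]
  refine iSup_le fun u => iSup_le fun v => iSup_le fun huv => ?_
  obtain ⟨u', v', hb, hv⟩ := exists_box_preimage c σ hc u v
  rw [← hv]
  refine le_iSup_of_le u' (le_iSup_of_le v' (le_iSup_of_le ?_ le_rfl))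
  rw [Set.disjoint_left] at huv ⊢
  intro y hy hyA
  have e : (fun i => c i * ((c (σ.symm (σ i)))⁻¹ * y (σ.symm (σ i)))) = y := by
    funext i
    rw [σ.symm_apply_apply, mul_inv_cancel_left₀ (hc i)]
  refine huv ((hb fun i => (c (σ.symm i))⁻¹ * y (σ.symm i)).1 ?_) ((h _).2 ?_)
  · rwa [e]
  · exact (congrArg (· ∈ colSpan A) e).mpr hyA

theorem Similar.matDisp_eq {A B : Matrix (Fin 2) (Fin 2) ℝ} (h : Similar A B) :
    matDisp A = matDisp B :=
  le_antisymm h.symm.matDisp_le h.matDisp_le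


/-! ### The lattice of a two-sided sequence -/

theorem det_seqMatrix (a : ℤ → ℕ+) (i : ℤ) : (seqMatrix a i).det = Δ a i - Δ' a i := by
  rw [seqMatrix, Matrix.det_fin_two_of]
  ring

theorem det_seqMatrix_pos (a : ℤ → ℕ+) (i : ℤ) : 0 < (seqMatrix a i).det := by
  rw [det_seqMatrix]
  linarith [one_lt_Δ a i, Δ'_neg a i]

theorem Irrational.eq_zero_of_add_mul_eq_zero {x : ℝ} (hx : Irrational x) {m n : ℤ}
    (h : m + n * x = 0) : m = 0 ∧ n = 0 := by
  have hn : n = 0 := by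
    by_contra hn
    have hn' : (n : ℝ) ≠ 0 := by exact_mod_cast hn
    refine hx ⟨(-m : ℚ) / n, ?_⟩
    push_cast
    rw [div_eq_iff hn']
    linarith
  subst hn
  simpa using h

/-- The lattice generated by `seqMatrix a 0`. -/
noncomputable def seqLattice (a : ℤ → ℕ+) : IrrationalLattice :=
  latticeOfMatrix (seqMatrix a 0) (det_seqMatrix_pos a 0).ne' fun m n k h => by
    fin_cases k
    · exact Irrational.eq_zero_of_add_mul_eq_zero (irrational_Δ a 0).neg (by simpa [seqMatrix] using h)
    · exact Irrational.eq_zero_of_add_mul_eq_zero (irrational_Δ' a 0).neg (by simpa [seqMatrix] using h)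

theorem generates_seqLattice (a : ℤ → ℕ+) :
    Generates (seqMatrix a 0) (seqLattice a).carrier :=
  generates_latticeOfMatrix _ _ _

/-! ### The two-sided chain of minimal vectors -/

/-- Two-sided orbits of a sequence of permutations exist. -/
theorem exists_int_orbit {X : Type*} (f : ℤ → Equiv.Perm X) (x₀ : X) :
    ∃ g : ℤ → X, g 0 = x₀ ∧ ∀ i, g (i + 1) = f i (g i) := by
  let p : ℕ → X := fun n => Nat.rec x₀ (fun n z => f n z) n
  let q : ℕ → X := fun n => Nat.rec x₀ (fun n z => (f (-(n : ℤ) - 1)).symm z) n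
  refine ⟨fun i => if 0 ≤ i then p i.toNat else q (-i).toNat, rfl, fun i => ?_⟩
  rcases le_or_gt 0 i with hi | hi
  · obtain ⟨n, rfl⟩ := Int.eq_ofNat_of_zero_le hi
    simp only [if_pos hi, if_pos (add_nonneg hi zero_le_one)]
    rfl
  · obtain ⟨n, rfl⟩ : ∃ n : ℕ, i = -(n : ℤ) - 1 := ⟨(-i - 1).toNat, by omega⟩
    have hq : q (n + 1) = (f (-(n : ℤ) - 1)).symm (q n) := rfl
    have h1 : (-(-(n : ℤ) - 1)).toNat = n + 1 := by omega
    simp only [if_neg hi.not_ge, h1, hq, Equiv.apply_symm_apply]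
    rcases Nat.eq_zero_or_pos n with rfl | hn
    · simp; rfl
    · rw [if_neg (by omega)]
      congr 1
      omega

/-- The coordinates of the chain of minimal vectors of the lattice of `a`. -/
structure IsChain (a : ℤ → ℕ+) (x y : ℤ → ℝ) : Prop where
  x_zero : x 0 = 1
  y_zero : y 0 = 1
  x_ne (i : ℤ) : x i ≠ 0
  y_pos (i : ℤ) : 0 < y i
  x_prev (i : ℤ) : x (i - 1) = -Δ a i * x i
  y_prev (i : ℤ) : y (i - 1) = -Δ' a i * y i

/-- Working in ℝˣ makes multiplication by each ratio a permutation, so the recursion runs both ways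
from index 0. Positivity of y spreads from y 0 = 1 because -Δ̃_i > 0. -/
theorem exists_isChain (a : ℤ → ℕ+) : ∃ x y, IsChain a x y := by
  have hΔ : ∀ i, -Δ a i ≠ 0 := fun i => by linarith [one_lt_Δ a i]
  have hΔ' : ∀ i, 0 < -Δ' a i := fun i => by linarith [Δ'_neg a i]
  obtain ⟨x, hx0, hx⟩ := exists_int_orbit
    (fun i => Equiv.mulRight (Units.mk0 _ (hΔ (i + 1)))⁻¹) (1 : ℝˣ)
  obtain ⟨y, hy0, hy⟩ := exists_int_orbit
    (fun i => Equiv.mulRight (Units.mk0 _ (hΔ' (i + 1)).ne')⁻¹) (1 : ℝˣ)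
  have hy' : ∀ i, ((y (i - 1) : ℝˣ) : ℝ) = -Δ' a i * y i := fun i => by
    have := hy (i - 1)
    rw [sub_add_cancel] at this
    have h := (hΔ' i).ne'
    simp [this]
    field_simp
    simp [(Δ'_neg a i).ne]
  refine ⟨fun i => x i, fun i => y i, by simp [hx0], by simp [hy0], fun i => (x i).ne_zero,
    fun i => ?_, fun i => ?_, hy'⟩
  · induction i using Int.induction_on with
    | zero => simp [hy0]
    | succ n ih =>
      have := hy' (n + 1)
      rw [add_sub_cancel_right] at this
      rw [this] at ih
      exact pos_of_mul_pos_right ih (hΔ' _).le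
    | pred n ih =>
      rw [hy']
      exact mul_pos (hΔ' _) ih
  · have := hx (i - 1)
    rw [sub_add_cancel] at this
    have h := (one_lt_Δ a i)
    have h0 : Δ a i ≠ 0 := by linarith
    simp [this]
    field_simp

namespace IsChain

variable {a : ℤ → ℕ+} {x y : ℤ → ℝ}

theorem x_succ (h : IsChain a x y) (i : ℤ) : x (i + 1) = x (i - 1) + (a i : ℕ) * x i := by
  have h1 := h.x_prev (i + 1)
  rw [add_sub_cancel_right] at h1
  have h2 : Δ a (i + 1) ≠ 0 := by linarith [one_lt_Δ a (i + 1)]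
  rw [h.x_prev i, Δ_eq a i, h1]
  field_simp
  ring

theorem y_succ (h : IsChain a x y) (i : ℤ) : y (i + 1) = y (i - 1) + (a i : ℕ) * y i := by
  have h1 := h.y_prev (i + 1)
  rw [add_sub_cancel_right] at h1
  have h2 : Δ' a (i + 1) ≠ 0 := by linarith [Δ'_neg a (i + 1)]
  have h3 : -Δ' a i = -(Δ' a (i + 1))⁻¹ - (a i : ℕ) := by rw [neg_inv_Δ']; ring
  rw [h.y_prev i, h3, h1]
  field_simp
  ring

theorem abs_x_prev (h : IsChain a x y) (i : ℤ) : |x (i - 1)| = Δ a i * |x i| := by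
  rw [h.x_prev, abs_mul, abs_neg, abs_of_pos (by linarith [one_lt_Δ a i])]

theorem abs_x_lt (h : IsChain a x y) (i : ℤ) : |x i| < |x (i - 1)| := by
  rw [h.abs_x_prev]
  nlinarith [one_lt_Δ a i, abs_pos.2 (h.x_ne i)]

theorem y_lt (h : IsChain a x y) (i : ℤ) : y (i - 1) < y i := by
  rw [h.y_prev]
  nlinarith [neg_one_lt_Δ' a i, h.y_pos i]

theorem y_strictMono (h : IsChain a x y) : StrictMono y :=
  strictMono_int_of_lt_succ fun i => by simpa using h.y_lt (i + 1)

theorem abs_x_strictAnti (h : IsChain a x y) : StrictAnti fun i => |x i| :=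
  strictAnti_int_of_succ_lt fun i => by simpa using h.abs_x_lt (i + 1)

/-- Δ_{i-1}Δ_i = a_{i-1}Δ_i + 1 ≥ 2, whereas a single ratio may be close to 1. This and
`two_mul_y_le` make the chain reach all scales. -/
theorem two_mul_abs_x_le (h : IsChain a x y) (i : ℤ) : 2 * |x i| ≤ |x (i - 2)| := by
  have h1 := h.abs_x_prev (i - 1)
  have h2 := Δ_eq a (i - 1)
  have h3 := one_le_pnat_cast (a (i - 1))
  have h4 := one_lt_Δ a i
  rw [sub_add_cancel] at h2
  rw [show i - 2 = i - 1 - 1 by ring, h1, h.abs_x_prev i, ← mul_assoc, h2]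
  refine mul_le_mul_of_nonneg_right ?_ (abs_nonneg _)
  rw [add_mul, one_div, inv_mul_cancel₀ (by linarith)]
  nlinarith

theorem two_mul_y_le (h : IsChain a x y) (i : ℤ) : 2 * y i ≤ y (i + 2) := by
  have h1 := h.y_succ (i + 1)
  have h2 := one_le_pnat_cast (a (i + 1))
  have h3 := h.y_lt (i + 1)
  have h4 := h.y_pos (i + 1)
  rw [add_sub_cancel_right] at h1 h3
  rw [show i + 2 = i + 1 + 1 by ring, h1]
  nlinarith

/-- Any two consecutive vectors of the chain form a basis of the lattice. -/
theorem mem_colSpan_iff (h : IsChain a x y) (i : ℤ) {p : Fin 2 → ℝ} :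
    p ∈ colSpan (seqMatrix a 0) ↔
      ∃ m n : ℤ, p 0 = m * x i + n * x (i - 1) ∧ p 1 = m * y i + n * y (i - 1) := by
  -- Passing from (p_i, p_{i-1}) to (p_{i+1}, p_i) is a unimodular change of basis.
  have step : ∀ i, (∃ m n : ℤ, p 0 = m * x i + n * x (i - 1) ∧ p 1 = m * y i + n * y (i - 1)) ↔
      ∃ m n : ℤ, p 0 = m * x (i + 1) + n * x (i + 1 - 1) ∧
        p 1 = m * y (i + 1) + n * y (i + 1 - 1) := by
    intro i
    rw [add_sub_cancel_right, h.x_succ, h.y_succ]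
    constructor
    · rintro ⟨m, n, h1, h2⟩
      refine ⟨n, m - (a i : ℕ) * n, ?_, ?_⟩ <;> push_cast <;> [rw [h1]; rw [h2]] <;> ring
    · rintro ⟨m, n, h1, h2⟩
      refine ⟨(a i : ℕ) * m + n, m, ?_, ?_⟩ <;> push_cast <;> [rw [h1]; rw [h2]] <;> ring
  induction i using Int.induction_on with
  | zero =>
    rw [mem_colSpan, h.x_prev, h.y_prev, h.x_zero, h.y_zero]
    simp only [Fin.forall_fin_two, seqMatrix]
    simp
  | succ n ih => exact ih.trans (step n)
  | pred n ih =>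
    have := step (-n - 1)
    rw [sub_add_cancel] at this
    exact ih.trans this.symm

theorem mem (h : IsChain a x y) (i : ℤ) : ![x i, y i] ∈ colSpan (seqMatrix a 0) :=
  (h.mem_colSpan_iff i).2 ⟨1, 0, by simp, by simp⟩

/-- There is no nonzero lattice point in the box spanned by two consecutive vectors. -/
theorem eq_zero_of_abs_lt (h : IsChain a x y) (i : ℤ) {p : Fin 2 → ℝ}
    (hp : p ∈ colSpan (seqMatrix a 0)) (h0 : |p 0| < |x (i - 1)|) (h1 : |p 1| < y i) : p = 0 := by
  obtain ⟨m, n, e0, e1⟩ := (h.mem_colSpan_iff i).1 hp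
  have hx := abs_pos.2 (h.x_ne i)
  have hy := h.y_pos i
  have hΔ := one_lt_Δ a i
  have hΔ' := Δ'_neg a i
  have hΔ1 := neg_one_lt_Δ' a i
  rw [h.abs_x_prev, e0, h.x_prev, show m * x i + n * (-Δ a i * x i) = (m - n * Δ a i) * x i by ring,
    abs_mul, mul_lt_mul_iff_left₀ hx, abs_lt] at h0
  rw [e1, h.y_prev, show m * y i + n * (-Δ' a i * y i) = (m - n * Δ' a i) * y i by ring,
    abs_mul, abs_of_pos hy, mul_lt_iff_lt_one_left hy, abs_lt] at h1
  -- Now |m - nΔ| < Δ and |m - nΔ̃| < 1, with Δ > 1 and -1 < Δ̃ < 0. For n ≠ 0, the first bound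
  -- fails if m = 0 or m and n have opposite signs, and the second fails if they have the same sign.
  have key : m = 0 ∧ n = 0 := by
    rcases lt_trichotomy n 0 with hn | rfl | hn
    · have hn' : (n : ℝ) ≤ -1 := by exact_mod_cast Int.le_sub_one_of_lt hn
      rcases le_or_gt m 0 with hm | hm
      · rcases hm.lt_or_eq with hm | rfl
        · have hm' : (m : ℝ) ≤ -1 := by exact_mod_cast Int.le_sub_one_of_lt hm
          nlinarith
        · push_cast at h0
          nlinarith
      · have hm' : (1 : ℝ) ≤ m := by exact_mod_cast hm
        nlinarith
    · push_cast at h1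
      refine ⟨?_, rfl⟩
      have h2 : (-1 : ℝ) < m := by linarith
      have h3 : (m : ℝ) < 1 := by linarith
      have h2' : -1 < m := by exact_mod_cast h2
      have h3' : m < 1 := by exact_mod_cast h3
      omega
    · have hn' : (1 : ℝ) ≤ n := by exact_mod_cast hn
      rcases le_or_gt 0 m with hm | hm
      · rcases hm.lt_or_eq with hm | rfl
        · have hm' : (1 : ℝ) ≤ m := by exact_mod_cast hm
          nlinarith
        · push_cast at h0
          nlinarith
      · have hm' : (m : ℝ) ≤ -1 := by exact_mod_cast Int.le_sub_one_of_lt hm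
        nlinarith
  obtain ⟨rfl, rfl⟩ := key
  funext k
  fin_cases k <;> simp [e0, e1]

end IsChain

theorem exists_lt_and_lt_of_two_mul_le {f : ℤ → ℝ} (hf : ∀ i, 0 < f i)
    (h2 : ∀ i, 2 * f i ≤ f (i + 2)) {t : ℝ} (ht : 0 < t) : (∃ i, f i < t) ∧ ∃ i, t < f i := by
  have up : ∀ n : ℕ, 2 ^ n * f 0 ≤ f (2 * n) := by
    intro n
    induction n with
    | zero => simp
    | succ n ih =>
      have := h2 (2 * n)
      push_cast
      rw [mul_add, mul_one, pow_succ]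
      linarith
  have down : ∀ n : ℕ, 2 ^ n * f (-(2 * n)) ≤ f 0 := by
    intro n
    induction n with
    | zero => simp
    | succ n ih =>
      have := h2 (-(2 * (n + 1)))
      rw [show -(2 * ((n : ℤ) + 1)) + 2 = -(2 * n) by ring] at this
      push_cast
      rw [pow_succ]
      have : (0 : ℝ) < 2 ^ n := by positivity
      nlinarith
  constructor
  · obtain ⟨n, hn⟩ := pow_unbounded_of_one_lt (f 0 / t) one_lt_two
    rw [div_lt_iff₀ ht] at hn
    exact ⟨_, lt_of_mul_lt_mul_left ((down n).trans_lt hn) (by positivity)⟩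
  · obtain ⟨n, hn⟩ := pow_unbounded_of_one_lt (t / f 0) one_lt_two
    rw [div_lt_iff₀ (hf 0)] at hn
    exact ⟨_, hn.trans_le (up n)⟩

theorem exists_lt_le_succ {f : ℤ → ℝ} (hf : ∀ i, 0 < f i) (hm : StrictMono f)
    (h2 : ∀ i, 2 * f i ≤ f (i + 2)) {t : ℝ} (ht : 0 < t) : ∃ i, f i < t ∧ t ≤ f (i + 1) := by
  obtain ⟨h, M, hM⟩ := exists_lt_and_lt_of_two_mul_le hf h2 ht
  obtain ⟨i, hi, hi'⟩ := Int.exists_greatest_of_bdd (P := fun i => f i < t)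
    ⟨M, fun z hz => (hm.lt_iff_lt.1 (hz.trans hM)).le⟩ h
  exact ⟨i, hi, le_of_not_gt fun h => by have := hi' _ h; omega⟩

theorem exists_le_lt_succ {f : ℤ → ℝ} (hf : ∀ i, 0 < f i) (hm : StrictMono f)
    (h2 : ∀ i, 2 * f i ≤ f (i + 2)) {t : ℝ} (ht : 0 < t) : ∃ i, f i ≤ t ∧ t < f (i + 1) := by
  obtain ⟨⟨N, hN⟩, M, hM⟩ := exists_lt_and_lt_of_two_mul_le hf h2 ht
  obtain ⟨i, hi, hi'⟩ := Int.exists_greatest_of_bdd (P := fun i => f i ≤ t)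
    ⟨M, fun z hz => (hm.lt_iff_lt.1 (hz.trans_lt hM)).le⟩ ⟨N, hN.le⟩
  exact ⟨i, hi, lt_of_not_ge fun h => by have := hi' _ h; omega⟩

/-! ### Minimal vectors determine the sequence -/

/-- `p` is a nonzero vector of the lattice of `A` such that the open box with corner `p`,
symmetric about the origin, contains no further lattice point. -/
def MinVec (A : Matrix (Fin 2) (Fin 2) ℝ) (p : Fin 2 → ℝ) : Prop :=
  p ∈ colSpan A ∧ p ≠ 0 ∧ ∀ w ∈ colSpan A, (∀ k, |w k| < |p k|) → w = 0

/-- For p minimal choose i with |x_i| ≤ |p_0| < |x_{i-1}|. The empty box forces |p_1| ≥ y_i, so p_i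
lies in the closed box of p. Minimality then makes one coordinate agree up to sign, and
irrationality gives p = ±p_i. -/
theorem IsChain.minVec_iff {a : ℤ → ℕ+} {x y : ℤ → ℝ} (h : IsChain a x y) {p : Fin 2 → ℝ} :
    MinVec (seqMatrix a 0) p ↔ ∃ i, p = ![x i, y i] ∨ p = -![x i, y i] := by
  constructor
  · rintro ⟨hp, h0, hmin⟩
    have hirr := (seqLattice a).irrational
    have hzero := fun k (hk : p k = 0) => h0 (hirr p hp 0 (zero_mem _) k hk)
    -- The index is negated because |x_i| decreases.
    obtain ⟨j, hj, hj'⟩ := exists_le_lt_succ (f := fun i => |x (-i)|) (t := |p 0|)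
      (fun i => abs_pos.2 (h.x_ne _)) (fun i j hij => h.abs_x_strictAnti (neg_lt_neg hij))
      (fun i => by
        have := h.two_mul_abs_x_le (-i)
        rwa [show -i - 2 = -(i + 2) by ring] at this)
      (abs_pos.2 fun h => hzero 0 h)
    rw [show -(j + 1) = -j - 1 by ring] at hj'
    generalize -j = i at hj hj'
    refine ⟨i, ?_⟩
    have hmem := h.mem i
    have close : ∀ k, |![x i, y i] k| = |p k| → p = ![x i, y i] ∨ p = -![x i, y i] := by
      intro k hk
      rcases abs_eq_abs.1 hk with hk | hk
      · exact Or.inl (hirr _ hp _ hmem k hk.symm)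
      · refine Or.inr (hirr _ hp _ (neg_mem hmem) k ?_)
        rw [Pi.neg_apply, hk, neg_neg]
    by_cases h1 : |p 1| < y i
    · exact absurd (h.eq_zero_of_abs_lt i hp hj' h1) h0
    · rw [not_lt] at h1
      rcases hj.lt_or_eq with hj | hj
      · rcases h1.lt_or_eq with h1 | h1
        · have := hmin _ hmem (Fin.forall_fin_two.2 ⟨hj, by simpa [abs_of_pos (h.y_pos i)] using h1⟩)
          exact absurd (congrFun this 0) (h.x_ne i)
        · exact close 1 (by simpa [abs_of_pos (h.y_pos i)] using h1)
      · exact close 0 hj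
  · rintro ⟨i, hi⟩
    have habs : |p 0| = |x i| ∧ |p 1| = y i := by
      rcases hi with rfl | rfl <;> simp [abs_of_pos (h.y_pos i)]
    refine ⟨?_, ?_, fun w hw hlt => ?_⟩
    · rcases hi with rfl | rfl
      · exact h.mem i
      · exact neg_mem (h.mem i)
    · rintro rfl
      have := h.x_ne i
      simp at habs
      exact this (abs_eq_zero.1 habs.1.symm)
    · refine h.eq_zero_of_abs_lt i hw ?_ ?_
      · exact ((hlt 0).trans_eq habs.1).trans (h.abs_x_lt i)
      · exact (hlt 1).trans_eq habs.2

theorem scale_surjective {c : Fin 2 → ℝ} (hc : ∀ i, c i ≠ 0) (σ : Equiv.Perm (Fin 2)) :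
    Function.Surjective fun (p : Fin 2 → ℝ) i => c i * p (σ i) := fun q =>
  ⟨fun i => (c (σ.symm i))⁻¹ * q (σ.symm i), funext fun i => by
    simp only [σ.symm_apply_apply, mul_inv_cancel_left₀ (hc i)]⟩

theorem minVec_image {A B : Matrix (Fin 2) (Fin 2) ℝ} {c : Fin 2 → ℝ} {σ : Equiv.Perm (Fin 2)}
    (hc : ∀ i, c i ≠ 0) (h : ∀ x, x ∈ colSpan B ↔ (fun i => c i * x (σ i)) ∈ colSpan A)
    (p : Fin 2 → ℝ) : MinVec A (fun i => c i * p (σ i)) ↔ MinVec B p := by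
  have hz : ∀ p : Fin 2 → ℝ, (fun i => c i * p (σ i)) = 0 ↔ p = 0 := fun p => by
    simp only [funext_iff, Pi.zero_apply, mul_eq_zero, hc, false_or]
    exact σ.forall_congr_right (q := fun i => p i = 0)
  have hsurj := scale_surjective hc σ
  rw [MinVec, MinVec, ← h, ne_eq, hz]
  refine and_congr_right fun _ => and_congr_right fun _ => ?_
  rw [hsurj.forall]
  refine forall_congr' fun w => ?_
  rw [← h, hz]
  refine imp_congr_right fun _ => imp_congr_left ?_
  rw [← σ.forall_congr_right (q := fun k => |w k| < |p k|)]
  simp only [abs_mul, mul_lt_mul_iff_right₀ (abs_pos.2 (hc _))]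

theorem eq_add_of_strictMono_of_surjective {f : ℤ → ℤ} (hm : StrictMono f)
    (hs : Function.Surjective f) (i : ℤ) : f i = f 0 + i := by
  have step : ∀ i, f (i + 1) = f i + 1 := fun i => by
    refine le_antisymm ?_ (hm (lt_add_one i))
    obtain ⟨j, hj⟩ := hs (f i + 1)
    rw [← hj]
    refine hm.monotone ?_
    have : f i < f j := by omega
    exact hm.lt_iff_lt.1 this
  induction i using Int.induction_on with
  | zero => simp
  | succ n ih => rw [step, ih]; ring
  | pred n ih =>
    have := step (-n - 1)
    rw [sub_add_cancel] at this
    linarith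

/-- The determinant of two plane vectors. -/
def cross (p q : Fin 2 → ℝ) : ℝ := p 0 * q 1 - p 1 * q 0

theorem cross_neg_left (p q : Fin 2 → ℝ) : cross (-p) q = -cross p q := by
  simp [cross]; ring

theorem cross_neg_right (p q : Fin 2 → ℝ) : cross p (-q) = -cross p q := by
  simp [cross]; ring

theorem abs_cross_comm (p q : Fin 2 → ℝ) : |cross p q| = |cross q p| := by
  rw [cross, cross, abs_sub_comm]
  ring_nf

theorem abs_cross_image (c : Fin 2 → ℝ) (σ : Equiv.Perm (Fin 2)) (p q : Fin 2 → ℝ) :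
    |cross (fun i => c i * p (σ i)) fun i => c i * q (σ i)| = |∏ i, c i| * |cross p q| := by
  rw [Fin.prod_univ_two, ← abs_mul, cross, cross]
  obtain h | h : (σ 0 = 0 ∧ σ 1 = 1) ∨ (σ 0 = 1 ∧ σ 1 = 0) := by
    revert σ; decide
  · rw [h.1, h.2]; ring_nf
  · rw [h.1, h.2, ← abs_neg]; ring_nf

namespace IsChain

variable {a : ℤ → ℕ+} {x y : ℤ → ℝ}

theorem abs_cross_prev (h : IsChain a x y) (i : ℤ) :
    |cross ![x (i - 1), y (i - 1)] ![x i, y i]| = (seqMatrix a 0).det := by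
  have step : ∀ i, |cross ![x (i - 1), y (i - 1)] ![x i, y i]|
      = |cross ![x (i + 1 - 1), y (i + 1 - 1)] ![x (i + 1), y (i + 1)]| := by
    intro i
    rw [abs_cross_comm, h.x_succ, h.y_succ, add_sub_cancel_right]
    simp only [cross, Matrix.cons_val_zero, Matrix.cons_val_one]
    ring_nf
  induction i using Int.induction_on with
  | zero =>
    rw [← abs_of_pos (det_seqMatrix_pos a 0), det_seqMatrix, h.x_prev, h.y_prev, h.x_zero, h.y_zero,
      ← abs_neg (Δ a 0 - _)]
    simp only [cross, Matrix.cons_val_zero, Matrix.cons_val_one]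
    ring_nf
  | succ n ih => rw [← step, ih]
  | pred n ih => rw [step (-n - 1), sub_add_cancel, ih]

/-- This recovers a_i from three consecutive minimal vectors and the covolume, both of which
`Similar` respects. -/
theorem abs_cross_prev_succ (h : IsChain a x y) (i : ℤ) :
    |cross ![x (i - 1), y (i - 1)] ![x (i + 1), y (i + 1)]|
      = (a i : ℕ) * (seqMatrix a 0).det := by
  rw [← h.abs_cross_prev i, h.x_succ, h.y_succ, ← Nat.abs_cast (a i : ℕ), ← abs_mul]
  simp only [cross, Matrix.cons_val_zero, Matrix.cons_val_one, Nat.abs_cast]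
  ring_nf

end IsChain

/-- Similar lattices come from equivalent sequences. -/
theorem seq_equiv_of_similar {a b : ℤ → ℕ+} (h : Similar (seqMatrix a 0) (seqMatrix b 0)) :
    a ≈ b := by
  obtain ⟨c, σ, hc, hmem, hd⟩ := h
  obtain ⟨x, y, hxy⟩ := exists_isChain a
  obtain ⟨z, w, hzw⟩ := exists_isChain b
  have h1 : ∀ i, ∃ j, (fun k => c k * ![z i, w i] (σ k)) = ![x j, y j] ∨
      (fun k => c k * ![z i, w i] (σ k)) = -![x j, y j] := fun i =>
    hxy.minVec_iff.1 ((minVec_image hc hmem _).2 (hzw.minVec_iff.2 ⟨i, Or.inl rfl⟩))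
  -- φ i is the index, in the chain of a, of the image of the i-th minimal vector of b.
  choose φ hφ using h1
  have habs : ∀ i, |c 1| * |![z i, w i] (σ 1)| = y (φ i) := fun i => by
    rw [← abs_mul, ← abs_of_pos (hxy.y_pos (φ i))]
    rcases hφ i with h | h <;> have := congrFun h 1 <;> rw [this] <;> simp
  have hsurj : Function.Surjective φ := by
    intro j
    have hj := hxy.minVec_iff.2 ⟨j, Or.inl rfl⟩
    obtain ⟨p, hp⟩ := scale_surjective hc σ ![x j, y j]
    rw [← hp, minVec_image hc hmem, hzw.minVec_iff] at hj
    obtain ⟨i, hi⟩ := hj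
    refine ⟨i, hxy.y_strictMono.injective ?_⟩
    rw [← habs, ← abs_of_pos (hxy.y_pos j)]
    have e1 : c 1 * p (σ 1) = y j := congrFun hp 1
    rw [← e1, abs_mul]
    congr 1
    rcases hi with hi | hi <;> rw [hi]
    rw [Pi.neg_apply, abs_neg]
  have hval : ∀ i, (φ (i - 1) = φ i - 1 ∧ φ (i + 1) = φ i + 1) ∨
      (φ (i - 1) = φ i + 1 ∧ φ (i + 1) = φ i - 1) → b i = a (φ i) := by
    intro i hi
    have e1 : |cross ![x (φ (i - 1)), y (φ (i - 1))] ![x (φ (i + 1)), y (φ (i + 1))]|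
        = (a (φ i) : ℕ) * (seqMatrix a 0).det := by
      rcases hi with hi | hi <;> rw [hi.1, hi.2]
      · exact hxy.abs_cross_prev_succ _
      · rw [abs_cross_comm]
        exact hxy.abs_cross_prev_succ _
    have e2 : |cross ![x (φ (i - 1)), y (φ (i - 1))] ![x (φ (i + 1)), y (φ (i + 1))]|
        = |∏ i, c i| * ((b i : ℕ) * (seqMatrix b 0).det) := by
      rw [← hzw.abs_cross_prev_succ, ← abs_cross_image c σ]
      rcases hφ (i - 1) with h | h <;> rcases hφ (i + 1) with h' | h' <;> rw [h, h'] <;>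
        simp only [cross_neg_left, cross_neg_right, abs_neg]
    have e3 : ((b i : ℕ) : ℝ) * (seqMatrix a 0).det = (a (φ i) : ℕ) * (seqMatrix a 0).det := by
      rw [← e1, e2, ← abs_of_pos (det_seqMatrix_pos a 0), hd,
        abs_of_pos (det_seqMatrix_pos b 0)]
      ring
    have e4 := mul_right_cancel₀ (det_seqMatrix_pos a 0).ne' e3
    exact PNat.eq (by exact_mod_cast e4)
  have hc1 := abs_pos.2 (hc 1)
  obtain hσ | hσ : σ 1 = 1 ∨ σ 1 = 0 := by
    generalize σ 1 = k
    fin_cases k <;> simp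
  · left
    have hm : StrictMono φ := fun i j hij => by
      rw [← hxy.y_strictMono.lt_iff_lt, ← habs, ← habs, mul_lt_mul_iff_right₀ hc1, hσ]
      simpa [abs_of_pos (hzw.y_pos _)] using hzw.y_strictMono hij
    have hs := eq_add_of_strictMono_of_surjective hm hsurj
    refine ⟨φ 0, fun i => ?_⟩
    rw [hval i (Or.inl ⟨by rw [hs, hs i]; ring, by rw [hs, hs i]; ring⟩), hs i, add_comm]
  -- The coordinates are swapped: heights in the lattice of a now come from the decreasing |z i|, so
  -- φ reverses the order.
  · right
    have hm : StrictMono fun i => φ (-i) := fun i j hij => by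
      rw [← hxy.y_strictMono.lt_iff_lt, ← habs, ← habs, mul_lt_mul_iff_right₀ hc1, hσ]
      exact hzw.abs_x_strictAnti (neg_lt_neg hij)
    have hs' := eq_add_of_strictMono_of_surjective hm (hsurj.comp neg_surjective)
    have hs : ∀ i, φ i = φ 0 - i := fun i => by
      have := hs' (-i)
      simp only [neg_neg, neg_zero] at this
      rw [this]; ring
    refine ⟨φ 0, fun i => ?_⟩
    rw [hval i (Or.inr ⟨by rw [hs, hs i]; ring, by rw [hs, hs i]; ring⟩), hs i]


/-! ### Shifts and reversals give equivalent lattices -/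

theorem matEquiv_diagonal_mul (A : Matrix (Fin 2) (Fin 2) ℝ) {c d : ℝ} (h : c * d ≠ 0) :
    MatEquiv A (Matrix.diagonal ![c, d] * A) :=
  Relation.EqvGen.rel _ _ (Step.diag A c d h)

theorem matEquiv_mul_unit (A : Matrix (Fin 2) (Fin 2) ℝ) (P : Matrix (Fin 2) (Fin 2) ℤ)
    (hP : IsUnit P.det) : MatEquiv A (A * P.map fun z : ℤ => (z : ℝ)) := by
  obtain ⟨U, rfl⟩ := (Matrix.isUnit_iff_isUnit_det P).2 hP
  exact Relation.EqvGen.rel _ _ (Step.right A U)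

/-- Right multiplication by (a_i 1; 1 0) sends a row (1, -z_i) to (a_i - z_i, 1) = -z_{i+1}⁻¹ (1,
-z_{i+1}), for z = Δ and z = Δ̃ alike. -/
theorem matEquiv_seqMatrix_succ (a : ℤ → ℕ+) (i : ℤ) :
    MatEquiv (seqMatrix a i) (seqMatrix a (i + 1)) := by
  have h1 : Δ a (i + 1) ≠ 0 := by linarith [one_lt_Δ a (i + 1)]
  have h2 : Δ' a (i + 1) ≠ 0 := by linarith [Δ'_neg a (i + 1)]
  have e1 := Δ_eq a i
  have e2 := neg_inv_Δ' a i
  refine Relation.EqvGen.trans _ _ _ (matEquiv_mul_unit _ !![(a i : ℕ), 1; 1, 0] (by simp))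
    (Relation.EqvGen.symm _ _ ?_)
  have e : seqMatrix a i * !![((a i : ℕ) : ℤ), 1; 1, 0].map (fun z : ℤ => (z : ℝ)) =
      Matrix.diagonal ![-(Δ a (i + 1))⁻¹, -(Δ' a (i + 1))⁻¹] * seqMatrix a (i + 1) := by
    ext k l
    fin_cases k <;> fin_cases l <;> simp [seqMatrix, Matrix.mul_apply, h1, h2]
    · rw [e1, one_div]; ring
    · linarith
  rw [e]
  exact matEquiv_diagonal_mul _
    (mul_ne_zero (neg_ne_zero.2 (inv_ne_zero h1)) (neg_ne_zero.2 (inv_ne_zero h2)))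

theorem matEquiv_seqMatrix (a : ℤ → ℕ+) (i : ℤ) : MatEquiv (seqMatrix a 0) (seqMatrix a i) := by
  induction i using Int.induction_on with
  | zero => exact Relation.EqvGen.refl _
  | succ n ih => exact Relation.EqvGen.trans _ _ _ ih (matEquiv_seqMatrix_succ a n)
  | pred n ih =>
    have := matEquiv_seqMatrix_succ a (-n - 1)
    rw [sub_add_cancel] at this
    exact Relation.EqvGen.trans _ _ _ ih (Relation.EqvGen.symm _ _ this)

theorem seqMatrix_shift (a : ℤ → ℕ+) (k i : ℤ) :
    seqMatrix (fun j => a (j + k)) i = seqMatrix a (i + k) := by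
  rw [seqMatrix, Δ_shift, Δ'_shift, seqMatrix]

/-- Swapping the rows exchanges the two ends at the cut between k and k + 1; rescaling and a quarter
turn restore the normal form. -/
theorem matEquiv_seqMatrix_reverse (a : ℤ → ℕ+) (k : ℤ) :
    MatEquiv (seqMatrix a (k + 1)) (seqMatrix (fun j => a (k - j)) 0) := by
  have h1 : Δ a (k + 1) ≠ 0 := by linarith [one_lt_Δ a (k + 1)]
  have h2 : Δ' a (k + 1) ≠ 0 := by linarith [Δ'_neg a (k + 1)]
  refine Relation.EqvGen.trans _ _ _ (Relation.EqvGen.rel _ _ (Step.swap _)) ?_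
  refine Relation.EqvGen.trans _ _ _ (matEquiv_diagonal_mul _
    (mul_ne_zero (neg_ne_zero.2 (inv_ne_zero h2)) (neg_ne_zero.2 (inv_ne_zero h1)))) ?_
  have e : seqMatrix (fun j => a (k - j)) 0 =
      Matrix.diagonal ![-(Δ' a (k + 1))⁻¹, -(Δ a (k + 1))⁻¹] *
        (!![0, 1; 1, 0] * seqMatrix a (k + 1)) *
          !![(0 : ℤ), -1; 1, 0].map (fun z : ℤ => (z : ℝ)) := by
    rw [seqMatrix, Δ_reverse, Δ'_reverse]
    ext i j
    fin_cases i <;> fin_cases j <;> simp [seqMatrix, Matrix.mul_apply, h1, h2]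
  rw [e]
  exact matEquiv_mul_unit _ _ (by simp)

theorem seqLattice_equiv {a b : ℤ → ℕ+} (h : a ≈ b) : seqLattice a ≈ seqLattice b := by
  refine ⟨_, _, generates_seqLattice a, generates_seqLattice b, ?_⟩
  rcases h with ⟨k, h⟩ | ⟨k, h⟩
  · obtain rfl : b = fun i => a (i + k) := funext h
    rw [seqMatrix_shift]
    exact matEquiv_seqMatrix a _
  · obtain rfl : b = fun i => a (k - i) := funext h
    exact Relation.EqvGen.trans _ _ _ (matEquiv_seqMatrix a (k + 1))
      (matEquiv_seqMatrix_reverse a k)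

/-! ### The dispersion of the lattice of a sequence -/

theorem le_matDisp_seqMatrix (a : ℤ → ℕ+) (i : ℤ) (j : Fin (a i)) :
    ENNReal.ofReal ((1 - (j : ℕ) + Δ a i) * (1 + (j : ℕ) - Δ' a i) / (Δ a i - Δ' a i))
      ≤ matDisp (seqMatrix a i) := by
  have hj : ((j : ℕ) : ℝ) + 1 ≤ (a i : ℕ) := by exact_mod_cast j.2
  have hj0 : (0 : ℝ) ≤ (j : ℕ) := Nat.cast_nonneg _
  have hΔ := lt_Δ a i
  have hΔ1 := one_lt_Δ a i
  have hΔ' := Δ'_neg a i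
  have hΔ'1 := neg_one_lt_Δ' a i
  have hd := det_seqMatrix_pos a i
  rw [matDisp, abs_of_pos hd, ← det_seqMatrix, ENNReal.ofReal_div_of_pos hd]
  gcongr
  -- With p_i = (1, 1) and p_{i-1} = (-Δ_i, -Δ̃_i), the bottom, right, left and top sides pass
  -- through 0, p_i, p_{i-1} + j p_i and p_{i-1} + (j+1) p_i. For a point m p_i + n p_{i-1} inside,
  -- n = 0 would force 0 < m < 1, n = 1 would force j < m < j + 1, and no other n fits.
  refine le_iSup_of_le ![(j : ℕ) - Δ a i, 0] (le_iSup_of_le ![1, 1 + (j : ℕ) - Δ' a i]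
    (le_iSup_of_le ?_ ?_))
  · rw [Set.disjoint_left]
    intro p hp hmem
    obtain ⟨m, n, h⟩ := mem_colSpan.1 hmem
    rw [mem_box, Fin.forall_fin_two, h, h] at hp
    simp [seqMatrix] at hp
    obtain ⟨⟨h1, h2⟩, h3, h4⟩ := hp
    generalize (j : ℕ) = t at *
    rcases lt_trichotomy n 0 with hn | rfl | hn
    · have hn' : (n : ℝ) ≤ -1 := by exact_mod_cast Int.le_sub_one_of_lt hn
      have hm : (0 : ℝ) < m := by nlinarith
      nlinarith
    · push_cast at h2 h3
      have hm : (m : ℝ) < 1 := by linarith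
      have hm' : (0 : ℝ) < m := by linarith
      have hm1 : m < 1 := by exact_mod_cast hm
      have hm2 : 0 < m := by exact_mod_cast hm'
      omega
    · rcases eq_or_lt_of_le (Int.add_one_le_of_lt hn) with hn1 | hn1
      · have hn2 : (n : ℝ) = 1 := by exact_mod_cast hn1.symm
        rw [hn2] at h1 h2 h3 h4
        have hm : (t : ℝ) < m := by linarith
        have hm' : (m : ℝ) < t + 1 := by linarith
        have hm1 : (t : ℤ) < m := by exact_mod_cast hm
        have hm2 : m < t + 1 := by exact_mod_cast hm'
        omega
      · have hn2 : (2 : ℝ) ≤ n := by exact_mod_cast hn1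
        nlinarith
  · rw [volume_box, ← ENNReal.ofReal_mul]
    · refine ENNReal.ofReal_le_ofReal (le_of_eq ?_)
      simp only [Matrix.cons_val_zero, Matrix.cons_val_one]
      ring
    · simp
      linarith

/-- An `L`-shaped region made of an `α × β` box and a `p × q` box tiles the plane, so that a box of
width above `α + p` and height above `q ≥ β` meets the lattice. -/
theorem exists_int_mem_box {α β p q l r b t : ℝ} (hα : 0 < α) (hβ : 0 < β) (hp : 0 < p)
    (hq : β ≤ q) (hw : α + p < r - l) (hh : q < t - b) :
    ∃ m n : ℤ, (l < m * α - n * p ∧ m * α - n * p < r) ∧ b < m * β + n * q ∧ m * β + n * q < t := by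
  obtain ⟨s, hs, hs'⟩ : ∃ s, b < s ∧ s + q < t :=
    ⟨(b + (t - q)) / 2, by linarith, by linarith⟩
  -- Walk leftwards inside the strip s ≤ Y < s + q: subtract (α, β) if that stays in the strip,
  -- otherwise add (-α - p, q - β). Each move goes left by at most α + p, so the walk cannot jump
  -- over the window (l, l + α + p]; it goes left by at least α, so N bounds its length.
  have descend : ∀ (N : ℕ) (m n : ℤ), s ≤ m * β + n * q → m * β + n * q < s + q →
      l < m * α - n * p → m * α - n * p ≤ l + α + p + N * α →
      ∃ m n : ℤ, (l < m * α - n * p ∧ m * α - n * p < r) ∧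
        b < m * β + n * q ∧ m * β + n * q < t := by
    intro N
    induction N with
    | zero =>
      intro m n h1 h2 h3 h4
      refine ⟨m, n, ⟨h3, ?_⟩, by linarith, by linarith⟩
      push_cast at h4
      linarith
    | succ N ih =>
      intro m n h1 h2 h3 h4
      by_cases hx : m * α - n * p ≤ l + α + p
      · exact ⟨m, n, ⟨h3, by linarith⟩, by linarith, by linarith⟩
      · push_cast at h4
        by_cases hy : s + β ≤ m * β + n * q
        · refine ih (m - 1) n ?_ ?_ ?_ ?_ <;> push_cast <;> linarith
        · refine ih (m - 1) (n + 1) ?_ ?_ ?_ ?_ <;> push_cast <;> linarith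
  have hq0 : 0 < q := hβ.trans_le hq
  -- Starting point: n = -k with k large puts it to the right of l, and rounding m up puts it in the
  -- strip because β ≤ q.
  obtain ⟨k, hk⟩ := exists_nat_gt ((l - α * (s / β)) / p)
  rw [div_lt_iff₀ hp] at hk
  have hm := Int.le_ceil ((s + k * q) / β)
  have hm' := Int.ceil_lt_add_one ((s + k * q) / β)
  rw [div_le_iff₀ hβ] at hm
  rw [← sub_lt_iff_lt_add, lt_div_iff₀ hβ] at hm'
  set m := ⌈(s + k * q) / β⌉
  have hl : l < m * α - (-k : ℤ) * p := by
    have h1 : α * (s / β) ≤ m * α := by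
      rw [mul_comm (m : ℝ)]
      refine mul_le_mul_of_nonneg_left ?_ hα.le
      rw [div_le_iff₀ hβ]
      have : (0 : ℝ) ≤ k * q := by positivity
      linarith
    push_cast
    linarith
  obtain ⟨N, hN⟩ := exists_nat_gt ((m * α - (-k : ℤ) * p) / α)
  obtain ⟨N', hN'⟩ := exists_nat_gt (-l / α)
  rw [div_lt_iff₀ hα] at hN hN'
  refine descend (N + N') m (-k) ?_ ?_ hl ?_
  · push_cast; linarith
  · push_cast; linarith
  · push_cast at hN ⊢; linarith

namespace IsChain

variable {a : ℤ → ℕ+} {x y : ℤ → ℝ}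

theorem det_eq (h : IsChain a x y) (i : ℤ) :
    |x i| * y i * (Δ a i - Δ' a i) = (seqMatrix a 0).det := by
  rw [← h.abs_cross_prev i, h.x_prev, h.y_prev, ← abs_neg,
    ← abs_of_pos (a := Δ a i - Δ' a i) (by linarith [one_lt_Δ a i, Δ'_neg a i]),
    ← abs_of_pos (h.y_pos i), ← abs_mul, ← abs_mul, abs_of_pos (h.y_pos i)]
  simp only [cross, Matrix.cons_val_zero, Matrix.cons_val_one]
  ring_nf

/-- Applies `exists_int_mem_box` to the basis p_i, p_{i-1} + j p_i. Its first coordinates have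
opposite signs and sizes |x_i| and |x_i|(Δ_i - j); j ≥ 1 gives y_i ≤ y_{i-1} + j y_i. -/
theorem exists_mem_box (h : IsChain a x y) (i : ℤ) {j : ℕ} (hj1 : 1 ≤ j) (hj : j ≤ a i)
    {u v : Fin 2 → ℝ} (hw : |x i| * (1 - j + Δ a i) < v 0 - u 0)
    (hh : y (i - 1) + j * y i < v 1 - u 1) :
    ∃ p ∈ colSpan (seqMatrix a 0), p ∈ box u v := by
  have hy := h.y_pos i
  have hy' := h.y_pos (i - 1)
  have hx := abs_pos.2 (h.x_ne i)
  have hj' : (j : ℝ) ≤ (a i : ℕ) := by exact_mod_cast hj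
  have hj1' : (1 : ℝ) ≤ j := by exact_mod_cast hj1
  have hΔ := lt_Δ a i
  have hp : 0 < |x i| * (Δ a i - j) := mul_pos hx (by linarith)
  have hq : y i ≤ y (i - 1) + j * y i := by nlinarith
  suffices ∃ m n : ℤ, (u 0 < (m + n * j) * x i + n * x (i - 1) ∧
      (m + n * j) * x i + n * x (i - 1) < v 0) ∧
      u 1 < m * y i + n * (y (i - 1) + j * y i) ∧ m * y i + n * (y (i - 1) + j * y i) < v 1 by
    obtain ⟨m, n, h0, h1⟩ := this
    refine ⟨![(m + n * j) * x i + n * x (i - 1), m * y i + n * (y (i - 1) + j * y i)],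
      (h.mem_colSpan_iff i).2 ⟨m + n * j, n, by simp, by simp; ring⟩, ?_⟩
    rw [mem_box, Fin.forall_fin_two]
    exact ⟨h0, h1⟩
  rcases lt_or_gt_of_ne (h.x_ne i) with hneg | hpos
  -- For x_i < 0 the picture is reflected horizontally.
  · obtain ⟨m, n, h0, h1⟩ := exists_int_mem_box (l := -v 0) (r := -u 0) hx hy hp hq
      (by linarith) hh
    rw [abs_of_neg hneg] at h0
    refine ⟨m, n, ⟨?_, ?_⟩, h1⟩ <;> rw [h.x_prev] <;> linarith
  · obtain ⟨m, n, h0, h1⟩ := exists_int_mem_box (l := u 0) (r := v 0) hx hy hp hq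
      (by linarith) hh
    rw [abs_of_pos hpos] at h0
    refine ⟨m, n, ⟨?_, ?_⟩, h1⟩ <;> rw [h.x_prev] <;> linarith

/-- The heights y_{i-1} + (1 + j) y_i with 0 ≤ j ≤ a_i, taken over all i, increase through all
scales, the last for i being the first for i + 1. If the height of the box exceeds the one for k and
is at most the one for k + 1, `exists_mem_box` with j = k + 1 bounds its width. -/
theorem exists_dim_le (h : IsChain a x y) {u v : Fin 2 → ℝ}
    (hd : ∀ p ∈ colSpan (seqMatrix a 0), p ∉ box u v) (hh : 0 < v 1 - u 1) :
    ∃ (i : ℤ) (j : Fin (a i)), v 0 - u 0 ≤ |x i| * (1 - (j : ℕ) + Δ a i) ∧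
      v 1 - u 1 ≤ y i * (1 + (j : ℕ) - Δ' a i) := by
  obtain ⟨i, hi, hi'⟩ := exists_lt_le_succ (f := fun i => y i + y (i - 1))
    (fun i => add_pos (h.y_pos _) (h.y_pos _))
    (fun i j hij => add_lt_add (h.y_strictMono hij) (h.y_strictMono (by omega)))
    (fun i => by
      have h1 := h.two_mul_y_le i
      have h2 := h.two_mul_y_le (i - 1)
      rw [show i - 1 + 2 = i + 2 - 1 by ring] at h2
      linarith) hh
  simp only [add_sub_cancel_right, h.y_succ] at hi'
  have hex : ∃ j : ℕ, v 1 - u 1 ≤ y i * (1 + j) + y (i - 1) := ⟨a i, by linarith⟩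
  classical
  obtain ⟨j, hj, hmin⟩ : ∃ j : ℕ, v 1 - u 1 ≤ y i * (1 + j) + y (i - 1) ∧
      ∀ k < j, y i * (1 + k) + y (i - 1) < v 1 - u 1 :=
    ⟨Nat.find hex, Nat.find_spec hex, fun k hk => lt_of_not_ge (Nat.find_min hex hk)⟩
  obtain ⟨k, rfl⟩ : ∃ k, j = k + 1 := by
    refine Nat.exists_eq_succ_of_ne_zero ?_
    rintro rfl
    push_cast at hj
    linarith
  have hja : k + 1 ≤ a i := by
    by_contra hlt
    have := hmin (a i) (by omega)
    linarith
  have hk := hmin k (by omega)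
  have hw : v 0 - u 0 ≤ |x i| * (1 - (k + 1 : ℕ) + Δ a i) := by
    by_contra hlt
    obtain ⟨p, hp, hp'⟩ := h.exists_mem_box i (j := k + 1) (by omega) hja (not_le.1 hlt)
      (by push_cast; linarith)
    exact hd p hp hp'
  rw [h.y_prev] at hj
  rcases hja.lt_or_eq with hlt | heq
  · exact ⟨i, ⟨k + 1, hlt⟩, hw, by simp only; linarith⟩
  -- The value j = a_i is outside the allowed range, but its dimensions are those of j = 0 at i + 1.
  · refine ⟨i + 1, ⟨0, (a (i + 1)).pos⟩, hw.trans_eq ?_, hj.trans_eq ?_⟩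
    · have h1 := h.abs_x_prev (i + 1)
      have h2 : Δ a (i + 1) ≠ 0 := by linarith [one_lt_Δ a (i + 1)]
      rw [add_sub_cancel_right] at h1
      rw [h1, heq, Δ_eq a i]
      push_cast
      field_simp
      ring
    · have h1 := h.y_prev (i + 1)
      have h2 := h.y_prev i
      have h3 := h.y_succ i
      rw [add_sub_cancel_right] at h1
      rw [heq]
      push_cast
      linarith

end IsChain

/-- The covolume is |x_i| y_i (Δ_i - Δ̃_i) for every i, which turns the dimension bounds into the
terms of `seqDisp`. For the lower bound the base point is moved to i. -/
theorem matDisp_seqMatrix (a : ℤ → ℕ+) : matDisp (seqMatrix a 0) = seqDisp a := by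
  refine le_antisymm ?_ (iSup_le fun i => iSup_le fun j => ?_)
  · obtain ⟨x, y, h⟩ := exists_isChain a
    have hd := det_seqMatrix_pos a 0
    refine ENNReal.div_le_of_le_mul (iSup_le fun u => iSup_le fun v => iSup_le fun huv => ?_)
    rw [volume_box, abs_of_pos hd]
    rcases le_or_gt (v 1 - u 1) 0 with hv | hv
    · rw [ENNReal.ofReal_of_nonpos hv, mul_zero]
      exact zero_le
    · obtain ⟨i, j, hw, hh⟩ := h.exists_dim_le
        (fun p hp hp' => Set.disjoint_left.1 huv hp' hp) hv
      have hj : ((j : ℕ) : ℝ) + 1 ≤ (a i : ℕ) := by exact_mod_cast j.2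
      have hW : 0 ≤ |x i| * (1 - (j : ℕ) + Δ a i) :=
        mul_nonneg (abs_nonneg _) (by linarith [lt_Δ a i])
      have hpos : 0 < Δ a i - Δ' a i := by linarith [one_lt_Δ a i, Δ'_neg a i]
      calc ENNReal.ofReal (v 0 - u 0) * ENNReal.ofReal (v 1 - u 1)
          ≤ ENNReal.ofReal (|x i| * (1 - (j : ℕ) + Δ a i)) *
              ENNReal.ofReal (y i * (1 + (j : ℕ) - Δ' a i)) := by gcongr
        _ = ENNReal.ofReal ((1 - (j : ℕ) + Δ a i) * (1 + (j : ℕ) - Δ' a i) / (Δ a i - Δ' a i)) *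
              ENNReal.ofReal (seqMatrix a 0).det := by
            rw [← ENNReal.ofReal_mul hW, ← ENNReal.ofReal_mul' hd.le, ← h.det_eq i]
            congr 1
            field_simp
        _ ≤ _ := by
            gcongr
            exact le_iSup₂ (f := fun (i : ℤ) (j : Fin (a i)) => ENNReal.ofReal
              ((1 - (j : ℕ) + Δ a i) * (1 + (j : ℕ) - Δ' a i) / (Δ a i - Δ' a i))) i j
  · rw [(similar_of_matEquiv (matEquiv_seqMatrix a i)).matDisp_eq]
    exact le_matDisp_seqMatrix a i j


/-! ### Every irrational lattice comes from a sequence -/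

namespace IrrationalLattice

variable (L : IrrationalLattice)

theorem apply_ne_zero {p : Fin 2 → ℝ} (hp : p ∈ L.carrier) (h0 : p ≠ 0) (k : Fin 2) : p k ≠ 0 :=
  fun h => h0 (L.irrational p hp 0 (zero_mem _) k h)

theorem finite_inter_abs_le (c d : ℝ) :
    {w | w ∈ L.carrier ∧ |w 0| ≤ c ∧ |w 1| ≤ d}.Finite := by
  obtain ⟨A, hA⟩ := L.exists_generates
  refine (ZSpan.setFinite_inter (colBasis A hA.1)
    (s := Set.Icc ![-c, -d] ![c, d]) (Metric.isBounded_Icc _ _)).subset ?_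
  rintro w ⟨hw, h0, h1⟩
  rw [abs_le] at h0 h1
  refine ⟨⟨?_, ?_⟩, ?_⟩
  · exact Fin.forall_fin_two.2 ⟨h0.1, h1.1⟩
  · exact Fin.forall_fin_two.2 ⟨h0.2, h1.2⟩
  · rw [← hA.2, colSpan_eq A hA.1] at hw
    exact hw

theorem exists_ne_zero : ∃ p ∈ L.carrier, p ≠ 0 := by
  obtain ⟨A, hA⟩ := L.exists_generates
  refine ⟨A.col 0, hA.2 ▸ Submodule.subset_span (Set.mem_range_self 0), fun h => hA.1 ?_⟩
  have h0 := congrFun h 0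
  have h1 := congrFun h 1
  simp at h0 h1
  rw [Matrix.det_fin_two, h0, h1]
  ring

/-- Lattice points come arbitrarily close to the vertical axis. -/
theorem exists_abs_lt {ε : ℝ} (hε : 0 < ε) : ∃ p ∈ L.carrier, p ≠ 0 ∧ |p 0| < ε := by
  obtain ⟨A, hA⟩ := L.exists_generates
  have hmem : ∀ m n : ℤ, (fun k => m * A k 0 + n * A k 1) ∈ L.carrier := fun m n => by
    rw [← hA.2]
    exact mem_colSpan.2 ⟨m, n, fun k => rfl⟩
  have hne : ∀ m n : ℤ, n ≠ 0 → (fun k => m * A k 0 + n * A k 1) ≠ 0 := fun m n hn h => by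
    have h0 := congrFun h 0
    have h1 := congrFun h 1
    simp only [Pi.zero_apply] at h0 h1
    have : n * A.det = 0 := by
      rw [Matrix.det_fin_two]
      linear_combination A 0 0 * h1 - A 1 0 * h0
    rcases mul_eq_zero.1 this with h | h
    · exact hn (by exact_mod_cast h)
    · exact hA.1 h
  by_cases hA0 : A 0 0 = 0
  · refine ⟨_, hmem 1 0, fun h => hA.1 ?_, by simpa [hA0] using hε⟩
    have h1 := congrFun h 1
    simp at h1
    rw [Matrix.det_fin_two, hA0, h1]
    ring
  · obtain ⟨N, hN⟩ := exists_nat_gt (|A 0 0| / ε)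
    rw [div_lt_iff₀ hε] at hN
    -- Dirichlet approximation of the ratio of the first-row entries gives a combination of the
    -- columns with small first coordinate.
    obtain ⟨j, k, hk, -, hjk⟩ :=
      Real.exists_int_int_abs_mul_sub_le (A 0 1 / A 0 0) (Nat.succ_pos N)
    refine ⟨_, hmem (-j) k, hne _ _ hk.ne', ?_⟩
    have e : ((-j : ℤ) : ℝ) * A 0 0 + k * A 0 1 = (k * (A 0 1 / A 0 0) - j) * A 0 0 := by
      push_cast
      field_simp
      ring
    have hN' : (0 : ℝ) < ((N.succ : ℕ) : ℝ) + 1 := by positivity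
    rw [e, abs_mul]
    refine (mul_le_mul_of_nonneg_right hjk (abs_nonneg _)).trans_lt ?_
    rw [one_div, inv_mul_lt_iff₀ hN']
    push_cast
    nlinarith

/-- There are two lattice vectors spanning a box, symmetric about the origin, that contains no
nonzero lattice point. -/
theorem exists_adjacent : ∃ v ∈ L.carrier, ∃ w ∈ L.carrier, w ≠ 0 ∧ |w 0| < |v 0| ∧ |v 1| < |w 1| ∧
    ∀ p ∈ L.carrier, |p 0| < |v 0| → |p 1| < |w 1| → p = 0 := by
  obtain ⟨p, hp, hp0⟩ := L.exists_ne_zero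
  obtain ⟨v, ⟨⟨hv, -, hv1⟩, hv0⟩, hvmin⟩ := Set.exists_min_image
    ({w | w ∈ L.carrier ∧ |w 0| ≤ |p 0| ∧ |w 1| ≤ |p 1|} ∩ {w | w ≠ 0}) (fun w => |w 0|)
    ((L.finite_inter_abs_le _ _).inter_of_left _) ⟨p, ⟨hp, le_rfl, le_rfl⟩, hp0⟩
  have hvp : |v 0| ≤ |p 0| := hvmin p ⟨⟨hp, le_rfl, le_rfl⟩, hp0⟩
  -- w is to be lowest among the nonzero points closer to the vertical axis than v; the point s
  -- shows that there are some and bounds the search. If |w 1| ≤ |v 1|, then w would contradict the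
  -- choice of v.
  obtain ⟨s, hs, hs0, hsv⟩ := L.exists_abs_lt (abs_pos.2 (L.apply_ne_zero hv hv0 0))
  obtain ⟨w, ⟨⟨hw, -, hw1⟩, hw0, hwv⟩, hwmin⟩ := Set.exists_min_image
    ({w | w ∈ L.carrier ∧ |w 0| ≤ |v 0| ∧ |w 1| ≤ |s 1|} ∩ {w | w ≠ 0 ∧ |w 0| < |v 0|})
    (fun w => |w 1|) ((L.finite_inter_abs_le _ _).inter_of_left _)
    ⟨s, ⟨hs, hsv.le, le_rfl⟩, hs0, hsv⟩
  refine ⟨v, hv, w, hw, hw0, hwv, ?_, fun q hq h0 h1 => ?_⟩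
  · by_contra hle
    exact (hvmin w ⟨⟨hw, hwv.le.trans hvp, (not_lt.1 hle).trans hv1⟩, hw0⟩).not_gt hwv
  · by_contra hq0
    exact (hwmin q ⟨⟨hq, h0.le, h1.le.trans hw1⟩, hq0, h0⟩).not_gt h1

/-- A generating matrix whose columns `(w₀, w₁)` and `(-s w₀, t w₁)` have `s > 1` and
`0 < t < 1`. -/
theorem exists_reduced : ∃ w : Fin 2 → ℝ, ∃ s t : ℝ, (∀ k, w k ≠ 0) ∧ 1 < s ∧ 0 < t ∧ t < 1 ∧
    Generates !![w 0, -s * w 0; w 1, t * w 1] L.carrier := by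
  obtain ⟨v, hv, w, hw, hw0, h0, h1, hempty⟩ := L.exists_adjacent
  have hwk := L.apply_ne_zero hw hw0
  have hv0 : v ≠ 0 := by
    rintro rfl
    simp at h0
    exact h0.not_ge (abs_nonneg _)
  have hvk := L.apply_ne_zero hv hv0
  obtain ⟨v, hv, hvk, h0, h1, hempty, hneg⟩ : ∃ v ∈ L.carrier, (∀ k, v k ≠ 0) ∧ |w 0| < |v 0| ∧
      |v 1| < |w 1| ∧ (∀ p ∈ L.carrier, |p 0| < |v 0| → |p 1| < |w 1| → p = 0) ∧
      v 0 / w 0 < 0 := by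
    rcases lt_or_gt_of_ne (div_ne_zero (hvk 0) (hwk 0)) with h | h
    · exact ⟨v, hv, hvk, h0, h1, hempty, h⟩
    · refine ⟨-v, neg_mem hv, fun k => neg_ne_zero.2 (hvk k), ?_, ?_, ?_, ?_⟩ <;>
        simp only [Pi.neg_apply, abs_neg]
      · exact h0
      · exact h1
      · exact hempty
      · rw [neg_div]; linarith
  obtain ⟨s, hs⟩ : ∃ s, s = -(v 0 / w 0) := ⟨_, rfl⟩
  obtain ⟨t, ht⟩ : ∃ t, t = v 1 / w 1 := ⟨_, rfl⟩
  have ev0 : v 0 = -s * w 0 := by rw [hs, neg_neg, div_mul_cancel₀ _ (hwk 0)]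
  have ev1 : v 1 = t * w 1 := by rw [ht, div_mul_cancel₀ _ (hwk 1)]
  have hw0' := abs_pos.2 (hwk 0)
  have hw1' := abs_pos.2 (hwk 1)
  have hs0 : 0 < s := by rw [hs]; linarith
  rw [ev0, abs_mul, abs_neg, abs_of_pos hs0] at h0 hempty
  rw [ev1, abs_mul] at h1
  have hs1 : 1 < s := by
    by_contra hle
    nlinarith
  have ht1 : |t| < 1 := by
    by_contra hle
    nlinarith
  -- If t < 0, then v + w would be a nonzero point of the empty box, since |1 - s| < s and |1 + t| <
  -- 1.
  have ht0 : 0 < t := by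
    rw [abs_lt] at ht1
    by_contra hle
    have ht' : t ≠ 0 := by rw [ht]; exact div_ne_zero (hvk 1) (hwk 1)
    have ht0 : t < 0 := lt_of_le_of_ne (not_lt.1 hle) ht'
    have := hempty (v + w) (add_mem hv hw) ?_ ?_
    · have e := congrFun this 1
      rw [Pi.add_apply, ev1, Pi.zero_apply, ← add_one_mul] at e
      rcases mul_eq_zero.1 e with e | e
      · linarith
      · exact hwk 1 e
    · rw [Pi.add_apply, ev0, ← add_one_mul, abs_mul]
      refine mul_lt_mul_of_pos_right ?_ hw0'
      rw [abs_lt]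
      constructor <;> linarith
    · rw [Pi.add_apply, ev1, ← add_one_mul, abs_mul]
      refine mul_lt_of_lt_one_left hw1' ?_
      rw [abs_lt]
      constructor <;> linarith
  rw [abs_of_pos ht0] at ht1
  refine ⟨w, s, t, hwk, hs1, ht0, ht1, ?_, le_antisymm ?_ ?_⟩
  · rw [Matrix.det_fin_two_of]
    have : w 0 * (t * w 1) - -s * w 0 * w 1 = w 0 * w 1 * (s + t) := by ring
    rw [this]
    exact mul_ne_zero (mul_ne_zero (hwk 0) (hwk 1)) (by linarith)
  · intro p hp
    obtain ⟨m, n, h⟩ := mem_colSpan.1 hp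
    have : p = m • w + n • v := by
      funext k
      rw [h]
      fin_cases k <;> simp [ev0, ev1]
    rw [this]
    exact add_mem (L.carrier.smul_mem _ hw) (L.carrier.smul_mem _ hv)
  · intro p hp
    -- α and β are the real coordinates of p in the basis w, v. Rounding them leaves a lattice point
    -- with coordinates at most (1 + s)/2 < s and (1 + t)/2 < 1 in units of |w 0| and |w 1|, so it
    -- vanishes.
    obtain ⟨β, hβ⟩ : ∃ β, β = (p 1 / w 1 - p 0 / w 0) / (s + t) := ⟨_, rfl⟩
    obtain ⟨α, hα⟩ : ∃ α, α = p 0 / w 0 + s * β := ⟨_, rfl⟩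
    have hst : s + t ≠ 0 := by linarith
    have e0 : p 0 = (α - s * β) * w 0 := by
      rw [hα, add_sub_cancel_right, div_mul_cancel₀ _ (hwk 0)]
    have e1 : p 1 = (α + t * β) * w 1 := by
      have : α + t * β = p 1 / w 1 := by
        have : (s + t) * β = p 1 / w 1 - p 0 / w 0 := by rw [hβ, mul_div_cancel₀ _ hst]
        linarith
      rw [this, div_mul_cancel₀ _ (hwk 1)]
    have hα' := abs_le.1 (abs_sub_round α)
    have hβ' := abs_le.1 (abs_sub_round β)
    have hz := hempty (p - round α • w - round β • v)
      (sub_mem (sub_mem hp (L.carrier.smul_mem _ hw)) (L.carrier.smul_mem _ hv)) ?_ ?_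
    · refine mem_colSpan.2 ⟨round α, round β, fun k => ?_⟩
      have := congrFun hz k
      simp only [Pi.sub_apply, zsmul_eq_mul, Pi.zero_apply] at this
      fin_cases k <;> simp [ev0, ev1] at this ⊢ <;> linarith
    · have : (p - round α • w - round β • v) 0
          = ((α - round α) - s * (β - round β)) * w 0 := by
        simp only [Pi.sub_apply, zsmul_eq_mul, Pi.mul_apply, Pi.intCast_apply]
        rw [e0, ev0]; ring
      rw [this, abs_mul]
      refine mul_lt_mul_of_pos_right ?_ hw0'
      rw [abs_lt]
      constructor <;> nlinarith
    · have : (p - round α • w - round β • v) 1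
          = ((α - round α) + t * (β - round β)) * w 1 := by
        simp only [Pi.sub_apply, zsmul_eq_mul, Pi.mul_apply, Pi.intCast_apply]
        rw [e1, ev1]; ring
      rw [this, abs_mul]
      refine mul_lt_of_lt_one_left hw1' ?_
      rw [abs_lt]
      constructor <;> nlinarith

end IrrationalLattice

theorem Irrational.of_forall_add_mul {x : ℝ} (h : ∀ m n : ℤ, (m : ℝ) + n * x = 0 → n = 0) :
    Irrational x := by
  rintro ⟨q, rfl⟩
  have e : (q : ℝ) * q.den = q.num := by exact_mod_cast Rat.mul_den_eq_num q
  have := h (-q.num) q.den (by push_cast; linarith)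
  exact q.den_nz (by exact_mod_cast this)

/-- Scaling w to (1, 1) turns a reduced basis into the matrix (1 -s; 1 t), so the sequence must have
Δ_0 = s and Δ̃_0 = -t; irrationality of the lattice makes both expansions infinite. -/
theorem exists_seqLattice_equiv (L : IrrationalLattice) : ∃ a, seqLattice a ≈ L := by
  obtain ⟨w, s, t, hw, hs, ht, ht1, hB⟩ := L.exists_reduced
  have hirr : ∀ (m n : ℤ) (k : Fin 2),
      m * !![w 0, -s * w 0; w 1, t * w 1] k 0 + n * !![w 0, -s * w 0; w 1, t * w 1] k 1 = 0 →
        n = 0 := by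
    intro m n k h
    have hp := L.irrational (fun k => m * !![w 0, -s * w 0; w 1, t * w 1] k 0 +
      n * !![w 0, -s * w 0; w 1, t * w 1] k 1) (hB.2 ▸ mem_colSpan.2 ⟨m, n, fun _ => rfl⟩) 0
      (zero_mem _) k h
    have h0 := congrFun hp 0
    have h1 := congrFun hp 1
    simp at h0 h1
    have e0 : (m - n * s) * w 0 = 0 := by linarith
    have e1 : (m + n * t) * w 1 = 0 := by linarith
    have e0' := (mul_eq_zero.1 e0).resolve_right (hw 0)
    have e1' := (mul_eq_zero.1 e1).resolve_right (hw 1)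
    have : (n : ℝ) * (s + t) = 0 := by linarith
    have := (mul_eq_zero.1 this).resolve_right (by linarith)
    exact_mod_cast this
  have his : Irrational s := Irrational.of_forall_add_mul fun m n h => by
    have := hirr m (-n) 0 (by
      simp
      linear_combination w 0 * h)
    omega
  have hit : Irrational t := Irrational.of_forall_add_mul fun m n h => hirr m n 1 (by
    simp
    linear_combination w 1 * h)
  obtain ⟨b, hb⟩ := exists_cfValue_eq his hs
  obtain ⟨c, hc⟩ := exists_cfValue_eq hit.inv ((one_lt_inv₀ ht).2 ht1)
  -- The expansion of 1/t is read backwards from index -1.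
  let a : ℤ → ℕ+ := fun i => if 0 ≤ i then b i.toNat else c (-1 - i).toNat
  have hΔ : Δ a 0 = s := by
    rw [← hb, Δ]
    congr 1
    funext n
    simp [a]
  have hΔ' : Δ' a 0 = -t := by
    rw [Δ', ← inv_inv t, ← hc, one_div]
    congr 3
    funext n
    have h1 : ¬(0 : ℤ) ≤ 0 - 1 - n := by omega
    have h2 : (-1 - ((0 : ℤ) - 1 - n)).toNat = n := by omega
    simp only [a, if_neg h1, h2]
  refine ⟨a, _, _, generates_seqLattice a, hB, ?_⟩
  have e : !![w 0, -s * w 0; w 1, t * w 1] = Matrix.diagonal ![w 0, w 1] * seqMatrix a 0 := by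
    rw [seqMatrix, hΔ, hΔ']
    ext i j
    fin_cases i <;> fin_cases j <;> simp [mul_comm]
  rw [e]
  exact matEquiv_diagonal_mul _ (mul_ne_zero (hw 0) (hw 1))

end NBA

/-! ### The bijection and the dispersion formula -/

theorem mainTheorem9 :
    ∃ Φ : Quotient NBA.latticeSetoid ≃ Quotient NBA.seqSetoid,
      (∀ (a : ℤ → ℕ+) (i : ℤ), ∃ L : NBA.IrrationalLattice,
        NBA.Generates (NBA.seqMatrix a i) L.carrier ∧ Φ ⟦L⟧ = ⟦a⟧) ∧
      (∀ (L : NBA.IrrationalLattice) (a : ℤ → ℕ+),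
        Φ ⟦L⟧ = ⟦a⟧ → NBA.normDisp L = NBA.seqDisp a) := by
  let Ψ : Quotient NBA.seqSetoid → Quotient NBA.latticeSetoid :=
    Quotient.map NBA.seqLattice fun _ _ h => NBA.seqLattice_equiv h
  have hΨ : Function.Bijective Ψ := by
    constructor
    · intro p q
      induction p using Quotient.inductionOn with | _ a
      induction q using Quotient.inductionOn with | _ b
      intro h
      exact Quotient.sound (NBA.seq_equiv_of_similar (NBA.similar_of_equiv (Quotient.exact h)
        (NBA.generates_seqLattice a) (NBA.generates_seqLattice b)))
    · intro p
      induction p using Quotient.inductionOn with | _ L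
      obtain ⟨a, ha⟩ := NBA.exists_seqLattice_equiv L
      exact ⟨⟦a⟧, Quotient.sound ha⟩
  refine ⟨(Equiv.ofBijective Ψ hΨ).symm, fun a i => ?_, fun L a h => ?_⟩
  -- Γ_i is the lattice of the sequence shifted by i, taken at base point 0.
  · refine ⟨NBA.seqLattice fun j => a (j + i), ?_, ?_⟩
    · have := NBA.generates_seqLattice fun j => a (j + i)
      rwa [NBA.seqMatrix_shift, zero_add] at this
    · rw [Equiv.symm_apply_eq]
      exact Quotient.sound (NBA.seqLattice_equiv (Setoid.symm (Or.inl ⟨i, fun _ => rfl⟩)))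
  · rw [Equiv.symm_apply_eq] at h
    obtain ⟨A, hA⟩ := L.exists_generates
    rw [NBA.normDisp_eq_matDisp hA, (NBA.similar_of_equiv (Quotient.exact h) hA
      (NBA.generates_seqLattice a)).matDisp_eq, NBA.matDisp_seqMatrix]
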